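/- **Theorem.** One dimensional clustering with neighborhoods can be solved exactly in $O(n\log n)$ time on a real RAM. In detail: an instance consists of $n\ge 0$ nonempty closed bounded intervals $C_i=[a_i,b_i]$ ($a_i\le b_i$) on the real line, given by their endpoints in arbitrary order and allowed to intersect, and an integer $k\ge 0$. For a finite set $S\subset\mathbb{R}$ let $d(C_i,S)=\min_{x\in C_i,\,s\in S}|x-s|$, with $d(C_i,\emptyset)=\infty$, and let the radius of $S$ be $\max_i d(C_i,S)$ (taken to be $0$ if $n=0$). The task is to output a set $S$ of exactly $k$ points whose radius is minimum among all sets of exactly $k$ real numbers. There are one real RAM program and one constant $K$ such that, on every instance, the program halts with a correct output $S$ after at most $K\,n\log n$ operations if $n\ge 2$ and $k\le n$, and after at most $K(n\log n+k+1)$ operations in all cases (with $0\log 0=0$). Here a real RAM program is a fixed program built from assignments, branches and while loops over arrays of natural numbers and arrays of real numbers with computed natural number indices. Reading or writing an array cell, a constant, addition, (truncated) subtraction, halving, comparison with $\le$, and each logical connective in a test, count as one operation each. Halving of naturals is rounded down, halving of reals is exact; the only constants available for reals are $0$ and $1$, and the program has no multiplication and no rounding of reals. -/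

import Mathlib

open scoped ENNReal

namespace Clustering

/-- Distance between two sets of real numbers, `⊤` if one of them is empty. For a nonempty compact
interval and a nonempty finite set the infimum is a minimum. -/
noncomputable def setDist (X Y : Set ℝ) : ℝ≥0∞ := ⨅ x ∈ X, ⨅ y ∈ Y, edist x y

/-- The radius of the set of centers `S` for the `n` closed intervals `[a i, b i]`: the maximum
distance of an interval to `S`. -/
noncomputable def radius {n : ℕ} (a b : Fin n → ℝ) (S : Finset ℝ) : ℝ≥0∞ :=
  ⨆ i : Fin n, setDist (Set.Icc (a i) (b i)) (S : Set ℝ)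

/-- `S` is an optimal set of exactly `k` centers for the closed intervals `[a i, b i]`. -/
def IsOptimal {n : ℕ} (a b : Fin n → ℝ) (k : ℕ) (S : Finset ℝ) : Prop :=
  S.card = k ∧ ∀ S' : Finset ℝ, S'.card = k → radius a b S ≤ radius a b S'

end Clustering

/-! A real RAM, presented as a structured language with unit-cost operations.

The memory consists of arrays of natural numbers and arrays of real numbers (a program mentions only
finitely many of them), addressed by computed natural numbers; a scalar variable is a cell with a
constant address. The operations on naturals are addition, truncated subtraction and halving; those
on reals are addition, subtraction and halving. There is no multiplication, no floor, and no other
passage from reals to naturals than comparison of reals in a test. -/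
namespace RealRAM

/-- Memory: `nat x i` and `real x i` are the cells with index `i` of the arrays with name `x`. -/
structure State where
  nat : ℕ → ℕ → ℕ
  real : ℕ → ℕ → ℝ

namespace State

/-- Overwrite one cell of a natural number array. -/
def setNat (s : State) (x i v : ℕ) : State :=
  { s with nat := Function.update s.nat x (Function.update (s.nat x) i v) }

/-- Overwrite one cell of a real array. -/
def setReal (s : State) (x i : ℕ) (v : ℝ) : State :=
  { s with real := Function.update s.real x (Function.update (s.real x) i v) }

end State

/-- Natural number expressions; `get x e` reads the cell of array `x` with index `e`. -/
inductive NatExpr where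
  | lit (c : ℕ)
  | get (x : ℕ) (e : NatExpr)
  | add (e f : NatExpr)
  | sub (e f : NatExpr)
  | half (e : NatExpr)

namespace NatExpr

def eval (s : State) : NatExpr → ℕ
  | lit c => c
  | get x e => s.nat x (e.eval s)
  | add e f => e.eval s + f.eval s
  | sub e f => e.eval s - f.eval s
  | half e => e.eval s / 2

/-- The number of operations in the expression. -/
def cost : NatExpr → ℕ
  | lit _ => 1
  | get _ e => e.cost + 1
  | add e f => e.cost + f.cost + 1
  | sub e f => e.cost + f.cost + 1
  | half e => e.cost + 1

end NatExpr

/-- Real number expressions; `get x e` reads the cell of array `x` with index `e`. -/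
inductive RealExpr where
  | zero
  | one
  | get (x : ℕ) (e : NatExpr)
  | add (e f : RealExpr)
  | sub (e f : RealExpr)
  | half (e : RealExpr)

namespace RealExpr

noncomputable def eval (s : State) : RealExpr → ℝ
  | zero => 0
  | one => 1
  | get x e => s.real x (e.eval s)
  | add e f => e.eval s + f.eval s
  | sub e f => e.eval s - f.eval s
  | half e => e.eval s / 2

/-- The number of operations in the expression. -/
def cost : RealExpr → ℕ
  | zero => 1
  | one => 1
  | get _ e => e.cost + 1
  | add e f => e.cost + f.cost + 1
  | sub e f => e.cost + f.cost + 1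
  | half e => e.cost + 1

end RealExpr

/-- Tests. -/
inductive Test where
  | natLe (e f : NatExpr)
  | realLe (e f : RealExpr)
  | neg (p : Test)
  | conj (p q : Test)

namespace Test

def holds (s : State) : Test → Prop
  | natLe e f => e.eval s ≤ f.eval s
  | realLe e f => e.eval s ≤ f.eval s
  | neg p => ¬ p.holds s
  | conj p q => p.holds s ∧ q.holds s

/-- The number of operations in the test. -/
def cost : Test → ℕ
  | natLe e f => e.cost + f.cost + 1
  | realLe e f => e.cost + f.cost + 1
  | neg p => p.cost + 1
  | conj p q => p.cost + q.cost + 1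

end Test

/-- Programs; `setNat x i e` and `setReal x i e` assign `e` to the cell of array `x` with
index `i`. -/
inductive Program where
  | skip
  | setNat (x : ℕ) (i e : NatExpr)
  | setReal (x : ℕ) (i : NatExpr) (e : RealExpr)
  | seq (c d : Program)
  | branch (p : Test) (c d : Program)
  | loop (p : Test) (c : Program)

/-- `Runs c s t s'`: the program `c`, started in the memory state `s`, halts in the state `s'` after
exactly `t` operations. (The relation is deterministic: `t` and `s'` are determined by `c`
and `s`, and do not exist if `c` runs forever from `s`.) -/
inductive Runs : Program → State → ℕ → State → Prop where
  | skip (s : State) : Runs .skip s 1 s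
  | setNat (x : ℕ) (i e : NatExpr) (s : State) :
      Runs (.setNat x i e) s (i.cost + e.cost + 1) (s.setNat x (i.eval s) (e.eval s))
  | setReal (x : ℕ) (i : NatExpr) (e : RealExpr) (s : State) :
      Runs (.setReal x i e) s (i.cost + e.cost + 1) (s.setReal x (i.eval s) (e.eval s))
  | seq {c d : Program} {s s' s'' : State} {t t' : ℕ} (hc : Runs c s t s') (hd : Runs d s' t' s'') :
      Runs (.seq c d) s (t + t') s''
  | branchTrue {p : Test} {c d : Program} {s s' : State} {t : ℕ} (hp : p.holds s)
      (hc : Runs c s t s') : Runs (.branch p c d) s (p.cost + t) s'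
  | branchFalse {p : Test} {c d : Program} {s s' : State} {t : ℕ} (hp : ¬ p.holds s)
      (hd : Runs d s t s') : Runs (.branch p c d) s (p.cost + t) s'
  | loopTrue {p : Test} {c : Program} {s s' s'' : State} {t t' : ℕ} (hp : p.holds s)
      (hc : Runs c s t s') (hl : Runs (.loop p c) s' t' s'') :
      Runs (.loop p c) s (p.cost + t + t') s''
  | loopFalse {p : Test} {c : Program} {s : State} (hp : ¬ p.holds s) :
      Runs (.loop p c) s p.cost s

end RealRAM

namespace Clustering

/-- The input: `n` and `k` in the cells with index 0 of the natural number arrays 0 and 1, the left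
and the right endpoints, in the given (arbitrary) order, in the real arrays 0 and 1, and 0 in all
other cells. -/
noncomputable def inputState {n : ℕ} (a b : Fin n → ℝ) (k : ℕ) : RealRAM.State where
  nat x i := if x = 0 ∧ i = 0 then n else if x = 1 ∧ i = 0 then k else 0
  real x i := if h : i < n then (if x = 0 then a ⟨i, h⟩ else if x = 1 then b ⟨i, h⟩ else 0) else 0

/-- The output: the set of the first `k` entries of the real array 2. -/
noncomputable def outputSet (k : ℕ) (s : RealRAM.State) : Finset ℝ :=
  (Finset.range k).image (s.real 2)

end Clustering

/-! Enlarge every interval by `d / 2` on both sides; a set of centers has radius at most `d / 2` iff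
it pierces all enlarged intervals. Going through the intervals by increasing right endpoint and
placing a center at the right end of each enlarged interval not yet pierced yields a piercing set
and also a chain of equally many intervals whose consecutive gaps (left endpoint minus previous
right endpoint) exceed `d`. Along the chain the enlarged intervals are disjoint, so the greedy set
has minimum size (`wp_greedy`, `GapChain.le_card`). Hence the optimal `d` is 0 or a gap, and after
sorting one value of `d` is tested in linear time.

The gaps form an `n × n` matrix `A y - B x` with `A`, `B` sorted, monotone along rows and columns.
The search keeps a bound `lo` beaten by every gap of some chain of `k + 1` intervals and a bound
`hi` for which `k` centers suffice. It looks only at indices that are multiples of a stride `2 ^ e`,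
which is halved from level to level. With `m` such indices, at most `16 * m` gaps lie strictly
between the bounds. A staircase walk lists them (`wp_collect`); after sorting, three bisection steps
leave at most `2 * m`; halving the stride makes this at most `4 * (2 * m) + 8 * m = 16 * m` again
(`card_window_le`). A level costs `O(m log n + n)`; the `m` decay geometrically and there are about
`log n` levels, so the total is `O(n log n)` (`sum_levelCost_le`).

At stride 1 bisection continues until no gap is strictly between the bounds. The chain with gaps
above `lo` then has gaps at least `hi`, so no `k` points have radius below `hi / 2`
(`GapChain.le_radius`). -/

namespace RealRAM

/-! ### Total correctness with running time: rules for the program constructs. -/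

/-- `wp c s Q`: the program `c` halts from `s`, and the number of operations and the final state
satisfy `Q`. -/
def wp (c : Program) (s : State) (Q : ℕ → State → Prop) : Prop :=
  ∃ t s', Runs c s t s' ∧ Q t s'

theorem wp_mono {c : Program} {s : State} {Q Q' : ℕ → State → Prop} (h : wp c s Q)
    (hQ : ∀ t s', Q t s' → Q' t s') : wp c s Q' := by
  obtain ⟨t, s', hr, hq⟩ := h
  exact ⟨t, s', hr, hQ _ _ hq⟩

theorem wp_skip {s : State} {Q : ℕ → State → Prop} (h : Q 1 s) : wp .skip s Q :=
  ⟨_, _, .skip s, h⟩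

theorem wp_setNat {x : ℕ} {i e : NatExpr} {s : State} {Q : ℕ → State → Prop}
    (h : Q (i.cost + e.cost + 1) (s.setNat x (i.eval s) (e.eval s))) :
    wp (.setNat x i e) s Q :=
  ⟨_, _, .setNat x i e s, h⟩

theorem wp_setReal {x : ℕ} {i : NatExpr} {e : RealExpr} {s : State} {Q : ℕ → State → Prop}
    (h : Q (i.cost + e.cost + 1) (s.setReal x (i.eval s) (e.eval s))) :
    wp (.setReal x i e) s Q :=
  ⟨_, _, .setReal x i e s, h⟩

theorem wp_seq {c d : Program} {s : State} {Q : ℕ → State → Prop}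
    (h : wp c s fun t s' => wp d s' fun t' s'' => Q (t + t') s'') : wp (.seq c d) s Q := by
  obtain ⟨t, s', hr, t', s'', hr', hq⟩ := h
  exact ⟨_, _, .seq hr hr', hq⟩

theorem wp_branch {p : Test} {c d : Program} {s : State} {Q : ℕ → State → Prop}
    (hc : p.holds s → wp c s fun t s' => Q (p.cost + t) s')
    (hd : ¬ p.holds s → wp d s fun t s' => Q (p.cost + t) s') : wp (.branch p c d) s Q := by
  by_cases hp : p.holds s
  · obtain ⟨t, s', hr, hq⟩ := hc hp
    exact ⟨_, _, .branchTrue hp hr, hq⟩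
  · obtain ⟨t, s', hr, hq⟩ := hd hp
    exact ⟨_, _, .branchFalse hp hr, hq⟩

theorem Test.cost_pos (p : Test) : 0 < p.cost := by
  cases p <;> simp [Test.cost]

/-- The rule for loops: `I φ s` is an invariant of the state `s` with potential `φ`. -/
theorem wp_loop {p : Test} {c : Program} (I : ℕ → State → Prop)
    (hstep : ∀ φ s, I φ s → p.holds s →
      wp c s fun t s' => ∃ φ', I φ' s' ∧ p.cost + t + φ' ≤ φ)
    {φ : ℕ} {s : State} (hI : I φ s) {Q : ℕ → State → Prop}
    (hQ : ∀ t φ' s', I φ' s' → ¬ p.holds s' → t + φ' ≤ φ + p.cost → Q t s') :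
    wp (.loop p c) s Q := by
  have key : wp (.loop p c) s fun t s' =>
      ∃ φ', I φ' s' ∧ ¬ p.holds s' ∧ t + φ' ≤ φ + p.cost := by
    clear hQ
    induction φ using Nat.strong_induction_on generalizing s with
    | _ φ ih =>
      by_cases hp : p.holds s
      · obtain ⟨t, s', hr, φ', hI', hle⟩ := hstep φ s hI hp
        -- Every test costs something, so the potential drops strictly even if the body were free;
        -- this makes the induction, and hence termination, go through.
        have := p.cost_pos
        obtain ⟨t', s'', hr', φ'', h1, h2, h3⟩ := ih φ' (by omega) hI'
        exact ⟨_, _, .loopTrue hp hr hr', φ'', h1, h2, by omega⟩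
      · exact ⟨_, _, .loopFalse hp, φ, hI, hp, by omega⟩
  exact wp_mono key fun t s' ⟨φ', h1, h2, h3⟩ => hQ t φ' s' h1 h2 h3

namespace State

@[simp] theorem nat_setNat_self (s : State) (x i v : ℕ) :
    (s.setNat x i v).nat x = Function.update (s.nat x) i v := by
  simp [setNat]

@[simp] theorem nat_setNat_ne (s : State) {x y : ℕ} (i v : ℕ) (h : y ≠ x) :
    (s.setNat x i v).nat y = s.nat y := by
  simp [setNat, h]

@[simp] theorem real_setNat (s : State) (x i v : ℕ) : (s.setNat x i v).real = s.real := rfl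

@[simp] theorem real_setReal_self (s : State) (x i : ℕ) (v : ℝ) :
    (s.setReal x i v).real x = Function.update (s.real x) i v := by
  simp [setReal]

@[simp] theorem real_setReal_ne (s : State) {x y : ℕ} (i : ℕ) (v : ℝ) (h : y ≠ x) :
    (s.setReal x i v).real y = s.real y := by
  simp [setReal, h]

@[simp] theorem nat_setReal (s : State) (x i : ℕ) (v : ℝ) : (s.setReal x i v).nat = s.nat := rfl

end State

/-- The cell with index `0` of a natural number array, used as a variable. -/
abbrev nv (x : ℕ) : NatExpr := .get x (.lit 0)

/-- The cell with index `0` of a real array, used as a variable. -/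
abbrev rv (x : ℕ) : RealExpr := .get x (.lit 0)

/-- Strictly less, on natural numbers. -/
abbrev natLt (e f : NatExpr) : Test := .natLe (.add e (.lit 1)) f

attribute [simp] NatExpr.eval NatExpr.cost RealExpr.eval RealExpr.cost Test.holds Test.cost

/-! ### Bottom-up merge sort of indices by real keys. -/

/-- Merging the runs `[l, mid)` and `[mid, e)` of `P` into `Q`: the cells before `i` and
before `j` have been moved to the cells of `Q` between `l` and `t`. -/
structure MergeInv (key : ℕ → ℝ) (N l mid e : ℕ) (P Q₀ : ℕ → ℕ) (i j t : ℕ) (Q : ℕ → ℕ) :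
    Prop where
  li : l ≤ i
  im : i ≤ mid
  mj : mid ≤ j
  je : j ≤ e
  sum : t + mid = i + j
  old : ∀ y < l, Q y = Q₀ y
  valid : ∀ y, l ≤ y → y < t → Q y < N
  surj : ∀ y, (l ≤ y ∧ y < i) ∨ (mid ≤ y ∧ y < j) → ∃ z, l ≤ z ∧ z < t ∧ Q z = P y
  sorted : ∀ y z, l ≤ y → y ≤ z → z < t → key (Q y) ≤ key (Q z)
  dom : ∀ y z, l ≤ y → y < t → (i ≤ z ∧ z < mid) ∨ (j ≤ z ∧ z < e) → key (Q y) ≤ key (P z)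

section Merge

variable {key : ℕ → ℝ} {N l mid e : ℕ} {P Q₀ : ℕ → ℕ} {i j t : ℕ} {Q : ℕ → ℕ}

/-- The moved entry is the least one left in its own run, and `hle` compares it with the head of the
other run, so it is below everything that remains; this is what `dom` needs. -/
theorem MergeInv.left (h : MergeInv key N l mid e P Q₀ i j t Q)
    (hP : ∀ y z, l ≤ y → y ≤ z → z < mid → key (P y) ≤ key (P z))
    (hP' : ∀ y z, mid ≤ y → y ≤ z → z < e → key (P y) ≤ key (P z))
    (hv : ∀ y < e, P y < N) (hi : i < mid) (hle : j < e → key (P i) ≤ key (P j)) :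
    MergeInv key N l mid e P Q₀ (i + 1) j (t + 1) (Function.update Q t (P i)) := by
  obtain ⟨li, im, mj, je, sum, old, valid, surj, sorted, dom⟩ := h
  refine ⟨by omega, hi, mj, je, by omega, ?_, ?_, ?_, ?_, ?_⟩
  · intro y hy
    rw [Function.update_of_ne (by omega), old y hy]
  · intro y hy hyt
    by_cases hyt' : y = t
    · subst hyt'; simpa using hv i (by omega)
    · rw [Function.update_of_ne hyt']; exact valid y hy (by omega)
  · intro y hy
    by_cases hyi : y = i
    · exact ⟨t, by omega, by omega, by simp [hyi]⟩
    · obtain ⟨z, h1, h2, h3⟩ := surj y (by omega)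
      exact ⟨z, h1, by omega, by rw [Function.update_of_ne (by omega), h3]⟩
  · intro y z hy hyz hz
    by_cases hzt : z = t
    · subst hzt
      by_cases hyt : y = z
      · subst hyt; exact le_rfl
      · rw [Function.update_of_ne hyt, Function.update_self]
        exact dom y i hy (by omega) (by omega)
    · rw [Function.update_of_ne hzt, Function.update_of_ne (by omega)]
      exact sorted y z hy hyz (by omega)
  · intro y z hy hyt hz
    by_cases hyt' : y = t
    · subst hyt'
      rw [Function.update_self]
      rcases hz with hz | hz
      · exact hP _ _ li (by omega) hz.2
      · exact (hle (by omega)).trans (hP' _ _ mj hz.1 hz.2)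
    · rw [Function.update_of_ne hyt']
      exact dom y z hy (by omega) (by omega)

theorem MergeInv.right (h : MergeInv key N l mid e P Q₀ i j t Q)
    (hP : ∀ y z, l ≤ y → y ≤ z → z < mid → key (P y) ≤ key (P z))
    (hP' : ∀ y z, mid ≤ y → y ≤ z → z < e → key (P y) ≤ key (P z))
    (hv : ∀ y < e, P y < N) (hj : j < e) (hle : i < mid → key (P j) ≤ key (P i)) :
    MergeInv key N l mid e P Q₀ i (j + 1) (t + 1) (Function.update Q t (P j)) := by
  obtain ⟨li, im, mj, je, sum, old, valid, surj, sorted, dom⟩ := h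
  refine ⟨li, im, by omega, hj, by omega, ?_, ?_, ?_, ?_, ?_⟩
  · intro y hy
    rw [Function.update_of_ne (by omega), old y hy]
  · intro y hy hyt
    by_cases hyt' : y = t
    · subst hyt'; simpa using hv j (by omega)
    · rw [Function.update_of_ne hyt']; exact valid y hy (by omega)
  · intro y hy
    by_cases hyi : y = j
    · exact ⟨t, by omega, by omega, by simp [hyi]⟩
    · obtain ⟨z, h1, h2, h3⟩ := surj y (by omega)
      exact ⟨z, h1, by omega, by rw [Function.update_of_ne (by omega), h3]⟩
  · intro y z hy hyz hz
    by_cases hzt : z = t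
    · subst hzt
      by_cases hyt : y = z
      · subst hyt; exact le_rfl
      · rw [Function.update_of_ne hyt, Function.update_self]
        exact dom y j hy (by omega) (by omega)
    · rw [Function.update_of_ne hzt, Function.update_of_ne (by omega)]
      exact sorted y z hy hyz (by omega)
  · intro y z hy hyt hz
    by_cases hyt' : y = t
    · subst hyt'
      rw [Function.update_self]
      rcases hz with hz | hz
      · exact (hle (by omega)).trans (hP _ _ li hz.1 hz.2)
      · exact hP' _ _ mj (by omega) hz.2
    · rw [Function.update_of_ne hyt']
      exact dom y z hy (by omega) (by omega)

end Merge

/-- The first `N` entries of `f`, in blocks of length `w`, are sorted by `key`. -/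
def BlockSorted (key : ℕ → ℝ) (w N : ℕ) (f : ℕ → ℕ) : Prop :=
  ∀ c i j, c * w ≤ i → i ≤ j → j < (c + 1) * w → j < N → key (f i) ≤ key (f j)

/-- Merge the runs `[l, mid)` and `[mid, e)` of the array `p` into the array 28; here `l`, `mid`
and `e` are the variables 22, 23 and 24. -/
def mergeRuns (x p : ℕ) : Program :=
  .seq (.setNat 25 (.lit 0) (nv 22)) <|
  .seq (.setNat 26 (.lit 0) (nv 23)) <|
  .seq (.setNat 27 (.lit 0) (nv 22)) <|
  .loop (natLt (nv 27) (nv 24)) <|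
  .seq (.branch (.conj (natLt (nv 25) (nv 23)) (.neg (.conj (natLt (nv 26) (nv 24))
          (.neg (.realLe (.get x (.get p (nv 25))) (.get x (.get p (nv 26))))))))
        (.seq (.setNat 28 (nv 27) (.get p (nv 25))) (.setNat 25 (.lit 0) (.add (nv 25) (.lit 1))))
        (.seq (.setNat 28 (nv 27) (.get p (nv 26))) (.setNat 26 (.lit 0) (.add (nv 26) (.lit 1))))) <|
  .setNat 27 (.lit 0) (.add (nv 27) (.lit 1))

theorem wp_mergeRuns {x p : ℕ} (hp : p < 20) {N l mid e : ℕ} {s : State}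
    (hl : s.nat 22 0 = l) (hm : s.nat 23 0 = mid) (he : s.nat 24 0 = e)
    (hlm : l ≤ mid) (hme : mid ≤ e)
    (hP : ∀ y z, l ≤ y → y ≤ z → z < mid → s.real x (s.nat p y) ≤ s.real x (s.nat p z))
    (hP' : ∀ y z, mid ≤ y → y ≤ z → z < e → s.real x (s.nat p y) ≤ s.real x (s.nat p z))
    (hv : ∀ y < e, s.nat p y < N) :
    wp (mergeRuns x p) s fun t s' => t ≤ 60 * (e - l) + 30 ∧ s'.real = s.real ∧
      (∀ y < 25, s'.nat y = s.nat y) ∧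
      MergeInv (s.real x) N l mid e (s.nat p) (s.nat 28) mid e e (s'.nat 28) := by
  have h1 : p ≠ 25 := by omega
  have h2 : p ≠ 26 := by omega
  have h3 : p ≠ 27 := by omega
  have h4 : p ≠ 28 := by omega
  unfold mergeRuns
  refine wp_seq (wp_setNat (wp_seq (wp_setNat (wp_seq (wp_setNat ?_)))))
  refine wp_loop (fun φ s' => s'.real = s.real ∧ (∀ y < 25, s'.nat y = s.nat y) ∧
      φ = 60 * (e - s'.nat 27 0) ∧
      MergeInv (s.real x) N l mid e (s.nat p) (s.nat 28) (s'.nat 25 0) (s'.nat 26 0)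
        (s'.nat 27 0) (s'.nat 28)) ?_ (φ := 60 * (e - l)) ?_ ?_
  · rintro φ s' ⟨hr, hf, rfl, hI⟩ ht
    have e1 : s'.nat 23 0 = mid := by rw [hf 23 (by norm_num), hm]
    have e2 : s'.nat 24 0 = e := by rw [hf 24 (by norm_num), he]
    have e3 : s'.nat p = s.nat p := hf p (by omega)
    simp only [Test.holds, NatExpr.eval, e2] at ht
    refine wp_seq (wp_branch (fun hb => ?_) (fun hb => ?_))
    · simp [e1, e2, e3, hr] at hb
      refine wp_seq (wp_setNat (wp_setNat (wp_setNat ?_)))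
      refine ⟨_, ⟨?_, ?_, rfl, ?_⟩, ?_⟩
      · simpa using hr
      · intro y hy
        have : y ≠ 25 := by omega
        have : y ≠ 26 := by omega
        have : y ≠ 27 := by omega
        have : y ≠ 28 := by omega
        simp [*]
      · have := hI.left hP hP' hv (by omega) (fun hj => hb.2 (by omega))
        simpa [h1, h2, h3, h4, e3] using this
      · simp
        omega
    · simp [e1, e2, e3, hr] at hb
      refine wp_seq (wp_setNat (wp_setNat (wp_setNat ?_)))
      have h5 := hI.im
      have h6 := hI.sum
      have h7 := hI.je
      refine ⟨_, ⟨?_, ?_, rfl, ?_⟩, ?_⟩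
      · simpa using hr
      · intro y hy
        have : y ≠ 25 := by omega
        have : y ≠ 26 := by omega
        have : y ≠ 27 := by omega
        have : y ≠ 28 := by omega
        simp [*]
      -- The right run cannot be exhausted here: with `j = e` and `t < e` the left run would be
      -- nonempty, and the failed test then gives `j < e`.
      · have := hI.right hP hP' hv (by by_contra; have := (hb (by omega)).1; omega)
          (fun hj => (hb (by omega)).2.le)
        simpa [h1, h2, h3, h4, e3] using this
      · simp
        omega
  · refine ⟨rfl, ?_, ?_, ?_⟩
    · intro y hy
      have : y ≠ 25 := by omega
      have : y ≠ 26 := by omega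
      have : y ≠ 27 := by omega
      simp [*]
    · simp [hl]
    · simp only [NatExpr.eval]
      simp only [ne_eq, Nat.reduceEqDiff, not_false_eq_true,
        State.nat_setNat_ne, State.nat_setNat_self, Function.update_self, hl, hm]
      refine ⟨le_rfl, hlm, le_rfl, hme, by omega, fun _ _ => rfl, ?_, ?_, ?_, ?_⟩ <;> intros <;> omega
  · rintro t φ' s' ⟨hr, hf, rfl, hI⟩ ht hle
    have e2 : s'.nat 24 0 = e := by rw [hf 24 (by norm_num), he]
    simp only [Test.holds, NatExpr.eval, e2] at ht
    simp at hle
    have h5 := hI.im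
    have h6 := hI.sum
    have h7 := hI.je
    refine ⟨by simp; omega, hr, hf, ?_⟩
    -- From `t + mid = i + j`, `i ≤ mid`, `j ≤ e` and `t ≥ e`, both runs are used up.
    have e5 : s'.nat 25 0 = mid := by omega
    have e6 : s'.nat 26 0 = e := by omega
    have e7 : s'.nat 27 0 = e := by omega
    rw [e5, e6, e7] at hI
    exact hI

/-- Copy the first `N` cells of the array 28 to the array `p`, where `N` is the variable 20. -/
def copyBack (p : ℕ) : Program :=
  .seq (.setNat 29 (.lit 0) (.lit 0)) <|
  .loop (natLt (nv 29) (nv 20)) <|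
  .seq (.setNat p (nv 29) (.get 28 (nv 29))) <|
  .setNat 29 (.lit 0) (.add (nv 29) (.lit 1))

theorem wp_copyBack {p : ℕ} (hp : p < 20) {s : State} :
    wp (copyBack p) s fun t s' => t ≤ 30 * s.nat 20 0 + 20 ∧ s'.real = s.real ∧
      (∀ y < 22, y ≠ p → s'.nat y = s.nat y) ∧ ∀ i < s.nat 20 0, s'.nat p i = s.nat 28 i := by
  have h1 : p ≠ 29 := by omega
  have h2 : p ≠ 20 := by omega
  have h3 : p ≠ 28 := by omega
  unfold copyBack
  refine wp_seq (wp_setNat ?_)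
  refine wp_loop (fun φ s' => s'.real = s.real ∧ (∀ y < 29, y ≠ p → s'.nat y = s.nat y) ∧
      φ = 30 * (s.nat 20 0 - s'.nat 29 0) ∧ ∀ i < s'.nat 29 0, s'.nat p i = s.nat 28 i)
      ?_ (φ := 30 * s.nat 20 0) ?_ ?_
  · rintro φ s' ⟨hr, hf, rfl, hI⟩ ht
    have e1 : s'.nat 20 0 = s.nat 20 0 := by rw [hf 20 (by norm_num) h2.symm]
    have e2 : s'.nat 28 = s.nat 28 := hf 28 (by norm_num) h3.symm
    simp [e1] at ht
    refine wp_seq (wp_setNat (wp_setNat ?_))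
    refine ⟨_, ⟨?_, ?_, rfl, ?_⟩, ?_⟩
    · simpa using hr
    · intro y hy hyp
      have : y ≠ 29 := by omega
      simp [*]
    · intro i hi
      simp [h1, h1.symm] at hi ⊢
      rcases Nat.lt_or_eq_of_le hi with h | h
      · rw [Function.update_of_ne (by omega), hI i h]
      · subst h; simp [e2]
    · simp [h1.symm]
      omega
  · refine ⟨rfl, ?_, ?_, ?_⟩
    · intro y hy hyp
      have : y ≠ 29 := by omega
      simp [*]
    · simp
    · simp
  · rintro t φ' s' ⟨hr, hf, rfl, hI⟩ ht hle
    have e1 : s'.nat 20 0 = s.nat 20 0 := by rw [hf 20 (by norm_num) h2.symm]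
    simp [e1] at ht hle ⊢
    refine ⟨by omega, hr, fun y hy => hf y (by omega), fun i hi => hI i (by omega)⟩

/-- Merge the adjacent sorted blocks of length `w` of the array `p`, for the key array `x`; here the
length `N` of the array and `w` are the variables 20 and 21. -/
def mergePass (x p : ℕ) : Program :=
  .seq (.setNat 22 (.lit 0) (.lit 0)) <|
  .seq (.loop (natLt (nv 22) (nv 20)) <|
    .seq (.setNat 23 (.lit 0) (.add (nv 22) (nv 21))) <|
    .seq (.branch (.natLe (nv 20) (nv 23)) (.setNat 23 (.lit 0) (nv 20)) .skip) <|
    .seq (.setNat 24 (.lit 0) (.add (nv 23) (nv 21))) <|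
    .seq (.branch (.natLe (nv 20) (nv 24)) (.setNat 24 (.lit 0) (nv 20)) .skip) <|
    .seq (mergeRuns x p) <|
    .setNat 22 (.lit 0) (nv 24)) <|
  copyBack p

/-- Every one of the first `N` entries of `P` occurs among those of `Q`. -/
def Covers (N : ℕ) (P Q : ℕ → ℕ) : Prop := ∀ y < N, ∃ z < N, Q z = P y

/-- A pair in a common block lies wholly in the old prefix, which is unchanged, or wholly in the
newly merged stretch. The minima with `N` cover a last block that is short or empty. -/
theorem BlockSorted.append {key : ℕ → ℝ} {w N c : ℕ} {P Q Q' : ℕ → ℕ}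
    (hQ : BlockSorted key (2 * w) (c * (2 * w)) Q)
    (hM : MergeInv key N (c * (2 * w)) (min (c * (2 * w) + w) N)
      (min (min (c * (2 * w) + w) N + w) N) P Q (min (c * (2 * w) + w) N)
      (min (min (c * (2 * w) + w) N + w) N) (min (min (c * (2 * w) + w) N + w) N) Q') :
    BlockSorted key (2 * w) (min ((c + 1) * (2 * w)) N) Q' := by
  intro c' i j hi hij hj hjN
  have e : (c + 1) * (2 * w) = c * (2 * w) + w + w := by ring
  rw [e] at hjN
  by_cases hjl : j < c * (2 * w)
  · rw [hM.old _ hjl, hM.old _ (by omega)]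
    exact hQ c' i j hi hij hj hjl
  · have : c ≤ c' := by
      by_contra hcc
      have := Nat.mul_le_mul_right (2 * w) (show c' + 1 ≤ c by omega)
      omega
    have := Nat.mul_le_mul_right (2 * w) this
    exact hM.sorted i j (by omega) hij (by omega)

theorem wp_mergePass {x p : ℕ} (hp : p < 20) {N w : ℕ} (hw : 1 ≤ w) {s : State}
    (hN : s.nat 20 0 = N) (hw' : s.nat 21 0 = w)
    (hs : BlockSorted (s.real x) w N (s.nat p)) (hv : ∀ y < N, s.nat p y < N) :
    wp (mergePass x p) s fun t s' => t ≤ 300 * N + 100 ∧ s'.real = s.real ∧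
      (∀ y < 22, y ≠ p → s'.nat y = s.nat y) ∧ (∀ y < N, s'.nat p y < N) ∧
      Covers N (s.nat p) (s'.nat p) ∧ BlockSorted (s.real x) (2 * w) N (s'.nat p) := by
  unfold mergePass
  have g1 : p ≠ 22 := by omega
  have g2 : p ≠ 23 := by omega
  have g3 : p ≠ 24 := by omega
  refine wp_seq (wp_setNat (wp_seq ?_))
  refine wp_loop (fun φ s' => s'.real = s.real ∧ (∀ y < 22, s'.nat y = s.nat y) ∧
      φ = 200 * (N - s'.nat 22 0) ∧ (∃ c, s'.nat 22 0 = min (c * (2 * w)) N) ∧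
      (∀ y < s'.nat 22 0, s'.nat 28 y < N) ∧
      Covers (s'.nat 22 0) (s.nat p) (s'.nat 28) ∧
      BlockSorted (s.real x) (2 * w) (s'.nat 22 0) (s'.nat 28))
      ?_ (φ := 200 * N) ?_ ?_
  · rintro φ s' ⟨hr, hf, rfl, ⟨c, hc⟩, hv', hcov, hbs⟩ ht
    have e1 : s'.nat 20 0 = N := by rw [hf 20 (by norm_num), hN]
    have e2 : s'.nat 21 0 = w := by rw [hf 21 (by norm_num), hw']
    have e3 : s'.nat p = s.nat p := hf p (by omega)
    simp [e1] at ht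
    have hc' : s'.nat 22 0 = c * (2 * w) := by omega
    have hcN : c * (2 * w) < N := by omega
    have e0 : (c + 1) * (2 * w) = c * (2 * w) + w + w := by ring
    have key : ∀ s₂ : State, s₂.real = s.real → (∀ y < 22, s₂.nat y = s.nat y) →
        s₂.nat 28 = s'.nat 28 → s₂.nat 22 0 = c * (2 * w) →
        s₂.nat 23 0 = min (c * (2 * w) + w) N →
        s₂.nat 24 0 = min (min (c * (2 * w) + w) N + w) N →
        wp (.seq (mergeRuns x p) (.setNat 22 (.lit 0) (nv 24))) s₂ fun t₂ s'' =>
        t₂ + 100 + 200 * (N - s''.nat 22 0) ≤ 200 * (N - s'.nat 22 0) ∧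
        s''.real = s.real ∧ (∀ y < 22, s''.nat y = s.nat y) ∧
        (∃ c, s''.nat 22 0 = min (c * (2 * w)) N) ∧
        (∀ y < s''.nat 22 0, s''.nat 28 y < N) ∧
        Covers (s''.nat 22 0) (s.nat p) (s''.nat 28) ∧
        BlockSorted (s.real x) (2 * w) (s''.nat 22 0) (s''.nat 28) := by
      intro s₂ i1 i2 i3 i4 i5 i6
      have i7 : s₂.nat p = s.nat p := i2 p (by omega)
      refine wp_seq (wp_mono (wp_mergeRuns hp i4 i5 i6 (by omega) (by omega)
        (N := N) ?_ ?_ ?_) ?_)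
      · intro y z hy hyz hz
        rw [i1, i7]
        -- The two runs merged into block `c` of width `2 * w` are the blocks `2 * c` and `2 * c +
        -- 1` of width `w`.
        exact hs (2 * c) y z (by
            have : 2 * c * w = c * (2 * w) := by ring
            omega) hyz (by
            have : (2 * c + 1) * w = c * (2 * w) + w := by ring
            omega) (by omega)
      · intro y z hy hyz hz
        rw [i1, i7]
        refine hs (2 * c + 1) y z ?_ hyz ?_ (by omega)
        · have : (2 * c + 1) * w = c * (2 * w) + w := by ring
          omega
        · have : (2 * c + 1 + 1) * w = c * (2 * w) + w + w := by ring
          omega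
      · intro y hy
        rw [i7]; exact hv y (by omega)
      · rintro t s₃ ⟨j1, j2, j3, j4⟩
        have j5 : s₃.nat 24 0 = min ((c + 1) * (2 * w)) N := by
          rw [j3 24 (by norm_num), i6, e0]; omega
        rw [i1, i7, i3] at j4
        rw [hc'] at hbs hcov hv'
        have j6 := hbs.append j4
        refine wp_setNat ?_
        simp only [NatExpr.eval, NatExpr.cost, State.nat_setNat_self, Function.update_self,
          State.real_setNat, j5, ne_eq, Nat.reduceEqDiff, not_false_eq_true, State.nat_setNat_ne]
        refine ⟨by omega, by rw [j2, i1], ?_, ⟨_, rfl⟩, ?_, ?_, j6⟩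
        · intro y hy
          rw [State.nat_setNat_ne _ _ _ (by omega), j3 y (by omega), i2 y hy]
        · intro y hy
          by_cases hyl : y < c * (2 * w)
          · rw [j4.old y hyl]; exact hv' y hyl
          · exact j4.valid y (by omega) (by omega)
        · intro y hy
          by_cases hyl : y < c * (2 * w)
          · obtain ⟨z, hz, hz'⟩ := hcov y hyl
            exact ⟨z, by omega, by rw [j4.old z hz, hz']⟩
          · obtain ⟨z, hz, hz', hz''⟩ := j4.surj y (by omega)
            exact ⟨z, by omega, hz''⟩
    refine wp_seq (wp_setNat (wp_seq (wp_branch (fun hb => ?_) (fun hb => ?_))))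
    · simp [e1, e2, hc'] at hb
      refine wp_setNat (wp_seq (wp_setNat (wp_seq (wp_branch (fun hb' => ?_) (fun hb' => ?_)))))
      · simp [e1, e2, hc'] at hb'
        refine wp_setNat (wp_mono (key _ ?_ ?_ ?_ ?_ ?_ ?_) ?_)
        · simpa using hr
        · intro y hy
          have : y ≠ 23 := by omega
          have : y ≠ 24 := by omega
          simp [*]
        · simp
        · simpa using hc'
        · simp [e1]; omega
        · simp [e1]; omega
        · rintro t s'' ⟨k1, k2, k3, k4⟩
          exact ⟨_, ⟨k2, k3, rfl, k4⟩, by simp; omega⟩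
      -- Impossible: the middle was already cut down to `N`, so the end reaches `N` too.
      · simp [e1, e2] at hb'
    · simp [e1, e2, hc'] at hb
      refine wp_skip (wp_seq (wp_setNat (wp_seq (wp_branch (fun hb' => ?_) (fun hb' => ?_)))))
      · simp [e1, e2, hc'] at hb'
        refine wp_setNat (wp_mono (key _ ?_ ?_ ?_ ?_ ?_ ?_) ?_)
        · simpa using hr
        · intro y hy
          have : y ≠ 23 := by omega
          have : y ≠ 24 := by omega
          simp [*]
        · simp
        · simpa using hc'
        · simp [e2, hc']; omega
        · simp [e1]; omega
        · rintro t s'' ⟨k1, k2, k3, k4⟩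
          exact ⟨_, ⟨k2, k3, rfl, k4⟩, by simp; omega⟩
      · simp [e1, e2, hc'] at hb'
        refine wp_skip (wp_mono (key _ ?_ ?_ ?_ ?_ ?_ ?_) ?_)
        · simpa using hr
        · intro y hy
          have : y ≠ 23 := by omega
          have : y ≠ 24 := by omega
          simp [*]
        · simp
        · simpa using hc'
        · simp [e2, hc']; omega
        · simp [e2, hc']; omega
        · rintro t s'' ⟨k1, k2, k3, k4⟩
          exact ⟨_, ⟨k2, k3, rfl, k4⟩, by simp; omega⟩
  · refine ⟨rfl, ?_, by simp, ⟨0, by simp⟩, ?_, ?_, ?_⟩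
    · intro y hy
      rw [State.nat_setNat_ne _ _ _ (by omega)]
    · simp
    · simp [Covers]
    · intro c i j _ _ _ hj
      simp at hj
  · rintro t φ' s' ⟨hr, hf, rfl, ⟨c, hc⟩, hv', hcov, hbs⟩ ht hle
    have e1 : s'.nat 20 0 = N := by rw [hf 20 (by norm_num), hN]
    simp [e1] at ht hle
    have e2 : s'.nat 22 0 = N := by omega
    rw [e2] at hv' hcov hbs
    refine wp_mono (wp_copyBack hp) ?_
    rintro t' s'' ⟨k1, k2, k3, k4⟩
    rw [e1] at k1 k4
    refine ⟨by simp; omega, by rw [k2, hr], ?_, ?_, ?_, ?_⟩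
    · intro y hy hyp
      rw [k3 y hy hyp, hf y hy]
    · intro y hy
      rw [k4 y hy]; exact hv' y hy
    · intro y hy
      obtain ⟨z, hz, hz'⟩ := hcov y hy
      exact ⟨z, hz, by rw [k4 z hz, hz']⟩
    · intro c i j h1 h2 h3 h4
      rw [k4 j h4, k4 i (by omega)]
      exact hbs c i j h1 h2 h3 h4

/-- Sort the indices below `N` by their keys in the real array `x`, where `N` is the variable 20,
and write them to the array `p`. -/
def sortIndices (x p : ℕ) : Program :=
  .seq (.setNat 29 (.lit 0) (.lit 0)) <|
  .seq (.loop (natLt (nv 29) (nv 20)) <|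
    .seq (.setNat p (nv 29) (nv 29)) <|
    .setNat 29 (.lit 0) (.add (nv 29) (.lit 1))) <|
  .seq (.setNat 21 (.lit 0) (.lit 1)) <|
  .loop (natLt (nv 21) (nv 20)) <|
  .seq (mergePass x p) <|
  .setNat 21 (.lit 0) (.add (nv 21) (nv 21))

/-- The first `N` entries of `f` are the numbers below `N`, sorted by `key`. -/
structure SortsBy (key : ℕ → ℝ) (N : ℕ) (f : ℕ → ℕ) : Prop where
  valid : ∀ i < N, f i < N
  surj : ∀ v < N, ∃ i < N, f i = v
  sorted : ∀ i j, i ≤ j → j < N → key (f i) ≤ key (f j)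

/-- The block width starts at 1 and doubles with each linear pass, so `Nat.clog 2 N` passes suffice.
It is enough to track surjectivity: `N` cells covering the numbers below `N` form a permutation. -/
theorem wp_sortIndices {x p : ℕ} (hp : p < 20) {N : ℕ} {s : State} (hN : s.nat 20 0 = N) :
    wp (sortIndices x p) s fun t s' => t ≤ 500 * (N + 1) * (Nat.clog 2 N + 1) ∧
      s'.real = s.real ∧ (∀ y < 21, y ≠ p → s'.nat y = s.nat y) ∧
      SortsBy (s.real x) N (s'.nat p) := by
  have g1 : p ≠ 29 := by omega
  have g2 : p ≠ 21 := by omega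
  have g3 : p ≠ 20 := by omega
  refine wp_seq (wp_setNat (wp_seq ?_))
  refine wp_loop (fun φ s' => s'.real = s.real ∧ (∀ y < 21, y ≠ p → s'.nat y = s.nat y) ∧
      φ = 30 * (N - s'.nat 29 0) ∧ ∀ i < s'.nat 29 0, s'.nat p i = i)
      ?_ (φ := 30 * N) ?_ ?_
  · rintro φ s' ⟨hr, hf, rfl, hI⟩ ht
    have e1 : s'.nat 20 0 = N := by rw [hf 20 (by norm_num) g3.symm, hN]
    simp [e1] at ht
    refine wp_seq (wp_setNat (wp_setNat ?_))
    refine ⟨_, ⟨?_, ?_, rfl, ?_⟩, ?_⟩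
    · simpa using hr
    · intro y hy hyp
      have : y ≠ 29 := by omega
      simp [*]
    · intro i hi
      simp [g1, g1.symm] at hi ⊢
      rcases Nat.lt_or_eq_of_le hi with h | h
      · rw [Function.update_of_ne (by omega), hI i h]
      · subst h; simp
    · simp [g1.symm]
      omega
  · refine ⟨rfl, ?_, by simp, by simp⟩
    intro y hy hyp
    rw [State.nat_setNat_ne _ _ _ (by omega)]
  · rintro t φ' s' ⟨hr, hf, rfl, hI⟩ ht hle
    have e1 : s'.nat 20 0 = N := by rw [hf 20 (by norm_num) g3.symm, hN]
    simp [e1] at ht hle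
    refine wp_seq (wp_setNat ?_)
    refine wp_loop (fun φ s' => s'.real = s.real ∧ (∀ y < 21, y ≠ p → s'.nat y = s.nat y) ∧
      ∃ e, s'.nat 21 0 = 2 ^ e ∧ φ = (300 * N + 130) * (Nat.clog 2 N - e) ∧
      (∀ i < N, s'.nat p i < N) ∧ (∀ v < N, ∃ i < N, s'.nat p i = v) ∧
      BlockSorted (s.real x) (2 ^ e) N (s'.nat p))
      ?_ (φ := (300 * N + 130) * Nat.clog 2 N) ?_ ?_
    · rintro φ s₂ ⟨hr, hf, e, he, rfl, hv, hs, hb⟩ ht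
      have e1 : s₂.nat 20 0 = N := by rw [hf 20 (by norm_num) g3.symm, hN]
      simp [e1, he] at ht
      have hlog : e < Nat.clog 2 N := (Nat.lt_clog_iff_pow_lt (by norm_num)).2 ht
      refine wp_seq (wp_mono (wp_mergePass hp Nat.one_le_two_pow e1 he (by rwa [hr]) hv) ?_)
      rintro t s₃ ⟨k1, k2, k3, k4, k5, k6⟩
      refine wp_setNat ?_
      refine ⟨_, ⟨?_, ?_, e + 1, ?_, rfl, ?_, ?_, ?_⟩, ?_⟩
      · rw [State.real_setNat, k2, hr]
      · intro y hy hyp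
        rw [State.nat_setNat_ne _ _ _ (by omega), k3 y (by omega) hyp, hf y hy hyp]
      · have : s₃.nat 21 0 = 2 ^ e := by rw [k3 21 (by norm_num) g2.symm, he]
        simp [this]; ring
      · simpa [g2] using k4
      · intro v hv
        obtain ⟨i, hi, hi'⟩ := hs v hv
        obtain ⟨j, hj, hj'⟩ := k5 i hi
        exact ⟨j, hj, by simp [g2, hj', hi']⟩
      · rw [hr] at k6
        rw [pow_succ']
        simpa [g2] using k6
      · simp
        have : Nat.clog 2 N - e = Nat.clog 2 N - (e + 1) + 1 := by omega
        rw [this, mul_add]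
        omega
    · refine ⟨hr, ?_, 0, by simp, by simp, ?_, ?_, ?_⟩
      · intro y hy hyp
        rw [State.nat_setNat_ne _ _ _ (by omega), hf y (by omega) hyp]
      · intro i hi
        simp only [State.nat_setNat_ne _ _ _ g2]
        rw [hI i (by omega)]; exact hi
      · intro i hi
        simp only [State.nat_setNat_ne _ _ _ g2]
        exact ⟨i, hi, hI i (by omega)⟩
      · intro c i j h1 h2 h3 h4
        have : i = j := by omega
        rw [this]
    · rintro t₂ φ' s₂ ⟨hr, hf, e, he, rfl, hv, hs, hb⟩ ht hle2
      have e1 : s₂.nat 20 0 = N := by rw [hf 20 (by norm_num) g3.symm, hN]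
      simp [e1, he] at ht hle2
      refine ⟨?_, hr, fun y hy => hf y (by omega), hv, hs, ?_⟩
      · have : 500 * (N + 1) * (Nat.clog 2 N + 1) =
          (300 * N + 130) * Nat.clog 2 N + (200 * N + 370) * Nat.clog 2 N + 500 * N + 500 := by ring
        simp
        omega
      · intro i j hij hj
        -- On exit the width is at least `N`, so block 0 is the whole array.
        exact hb 0 i j (by simp) hij (by simp; omega) hj

end RealRAM

namespace Clustering

/-! ### Duality between piercing sets and chains of intervals with large gaps. -/

/-- There is a sequence of `len` intervals such that the gap from each to the next satisfies `R`. -/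
def GapChain (α β : ℕ → ℝ) (n len : ℕ) (R : ℝ → Prop) : Prop :=
  ∃ c : ℕ → ℕ, (∀ j < len, c j < n) ∧ ∀ j, j + 1 < len → R (α (c (j + 1)) - β (c j))

/-- Every interval, enlarged by `d / 2` on both sides, contains a point of `S`. -/
def Pierces (α β : ℕ → ℝ) (n : ℕ) (d : ℝ) (S : Finset ℝ) : Prop :=
  ∀ i < n, ∃ x ∈ S, α i - d / 2 ≤ x ∧ x ≤ β i + d / 2

theorem le_card_of_increasing {len : ℕ} {S : Finset ℝ} {y : ℕ → ℝ} (hy : ∀ j < len, y j ∈ S)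
    (hlt : ∀ j, j + 1 < len → y j < y (j + 1)) : len ≤ S.card := by
  have hmono : ∀ i j, i < j → j < len → y i < y j := by
    intro i j hij
    induction j, hij using Nat.le_induction with
    | base => exact hlt i
    | succ j _ ih => exact fun h => (ih (by omega)).trans (hlt j h)
  have := Finset.card_le_card_of_injOn (s := Finset.range len) (t := S) y
    (fun j hj => hy j (Finset.mem_range.1 hj)) (by
      intro i hi j hj hij
      simp only [Finset.coe_range, Set.mem_Iio] at hi hj
      rcases lt_trichotomy i j with h | h | h
      · exact absurd hij (hmono i j h hj).ne
      · exact h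
      · exact absurd hij (hmono j i h hi).ne')
  simpa using this

theorem GapChain.mono {α β : ℕ → ℝ} {n len len' : ℕ} {R R' : ℝ → Prop}
    (h : GapChain α β n len R) (hl : len' ≤ len)
    (hR : ∀ i < n, ∀ j < n, R (α i - β j) → R' (α i - β j)) : GapChain α β n len' R' := by
  obtain ⟨c, hc, hg⟩ := h
  exact ⟨c, fun j hj => hc j (by omega),
    fun j hj => hR _ (hc _ (by omega)) _ (hc _ (by omega)) (hg j (by omega))⟩

/-- A gap above `d` separates consecutive intervals even after enlarging by `d / 2`, so the points
piercing them are strictly increasing. -/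
theorem GapChain.le_card {α β : ℕ → ℝ} {n len : ℕ} {d : ℝ} {S : Finset ℝ}
    (h : GapChain α β n len (d < ·)) (hS : Pierces α β n d S) : len ≤ S.card := by
  obtain ⟨c, hc, hg⟩ := h
  have : ∀ j, ∃ x, j < len → x ∈ S ∧ α (c j) - d / 2 ≤ x ∧ x ≤ β (c j) + d / 2 := by
    intro j
    by_cases hj : j < len
    · obtain ⟨x, hx, hx'⟩ := hS (c j) (hc j hj)
      exact ⟨x, fun _ => ⟨hx, hx'⟩⟩
    · exact ⟨0, fun h => absurd h hj⟩
  choose y hy using this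
  refine le_card_of_increasing (y := y) (fun j hj => (hy j hj).1) fun j hj => ?_
  have := hy j (by omega)
  have := hy (j + 1) hj
  have := hg j hj
  linarith

/-- No set of fewer than `len` points has a radius less than half the smallest gap of a chain
of `len` intervals. -/
theorem GapChain.le_radius {n len : ℕ} {a b : Fin n → ℝ} {α β : ℕ → ℝ}
    (hα : ∀ i : Fin n, α i = a i) (hβ : ∀ i : Fin n, β i = b i) {d : ℝ}
    (h : GapChain α β n len (d ≤ ·)) {S : Finset ℝ} (hS : S.card < len) :
    ENNReal.ofReal (d / 2) ≤ radius a b S := by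
  by_contra! hlt
  obtain ⟨c, hc, hg⟩ := h
  -- A radius below `d / 2` puts a center strictly inside each enlarged interval; this strictness
  -- replaces that of the gaps, which may now equal `d`.
  have key : ∀ i : Fin n, ∃ x ∈ S, a i - d / 2 < x ∧ x < b i + d / 2 := by
    intro i
    have h1 : setDist (Set.Icc (a i) (b i)) (S : Set ℝ) < ENNReal.ofReal (d / 2) :=
      lt_of_le_of_lt (le_iSup (fun i => setDist (Set.Icc (a i) (b i)) (S : Set ℝ)) i) hlt
    simp only [setDist, iInf_lt_iff] at h1
    obtain ⟨x, hx, y, hy, hxy⟩ := h1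
    rw [edist_dist, ENNReal.ofReal_lt_ofReal_iff_of_nonneg dist_nonneg, Real.dist_eq,
      abs_lt] at hxy
    exact ⟨y, hy, by linarith [hx.1, hx.2], by linarith [hx.1, hx.2]⟩
  have : ∀ j, ∃ x, j < len → x ∈ S ∧ α (c j) - d / 2 < x ∧ x < β (c j) + d / 2 := by
    intro j
    by_cases hj : j < len
    · obtain ⟨x, hx, hx'⟩ := key ⟨c j, hc j hj⟩
      rw [← hα, ← hβ] at hx'
      exact ⟨x, fun _ => ⟨hx, hx'⟩⟩
    · exact ⟨0, fun h => absurd h hj⟩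
  choose y hy using this
  refine absurd (le_card_of_increasing (y := y) (fun j hj => (hy j hj).1) fun j hj => ?_)
    (not_le.2 hS)
  have := hy j (by omega)
  have := hy (j + 1) hj
  have := hg j hj
  linarith

theorem radius_le_of_pierces {n : ℕ} {a b : Fin n → ℝ} (hab : ∀ i, a i ≤ b i) {α β : ℕ → ℝ}
    (hα : ∀ i : Fin n, α i = a i) (hβ : ∀ i : Fin n, β i = b i) {d : ℝ} (hd : 0 ≤ d)
    {S : Finset ℝ} (hS : Pierces α β n d S) : radius a b S ≤ ENNReal.ofReal (d / 2) := by
  refine iSup_le fun i => ?_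
  obtain ⟨x, hx, h1, h2⟩ := hS i i.2
  rw [hα] at h1
  rw [hβ] at h2
  have hi := hab i
  -- The point of the interval nearest to `x` is `x` clamped to `[a i, b i]`.
  refine (iInf₂_le (max (a i) (min x (b i))) ⟨le_max_left _ _, max_le hi (min_le_right _ _)⟩).trans
    ((iInf₂_le x hx).trans ?_)
  rw [edist_dist]
  refine ENNReal.ofReal_le_ofReal ?_
  rw [Real.dist_eq, abs_le]
  rcases max_cases (a i) (min x (b i)) with ⟨h, h'⟩ | ⟨h, h'⟩ <;>
    rcases min_cases x (b i) with ⟨g, g'⟩ | ⟨g, g'⟩ <;> rw [h] <;>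
    constructor <;> linarith

end Clustering

namespace RealRAM

open Clustering

/-! ### The greedy test in linear time. -/

/-- Choose centers greedily for the radius `d / 2`, where `d` is the real variable 6: go through the
intervals by increasing right endpoint (array 3) and add the right endpoint plus `d / 2` for every
interval that is not yet pierced. The centers are in the real array 2, their number is the
variable 11. -/
def greedy : Program :=
  .seq (.setNat 10 (.lit 0) (.lit 0)) <|
  .seq (.setNat 11 (.lit 0) (.lit 0)) <|
  .loop (natLt (nv 10) (nv 0)) <|
  .seq (.branch (.conj (.natLe (.lit 1) (nv 11))
        (.realLe (.get 0 (.get 3 (nv 10))) (.add (.get 2 (.sub (nv 11) (.lit 1))) (.half (rv 6)))))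
      .skip
      (.seq (.setReal 2 (nv 11) (.add (.get 1 (.get 3 (nv 10))) (.half (rv 6)))) <|
        .setNat 11 (.lit 0) (.add (nv 11) (.lit 1)))) <|
  .setNat 10 (.lit 0) (.add (nv 10) (.lit 1))

/-- The greedy choice of the centers `out 0, …, out (cnt - 1)` after the first `m` of the intervals
in the order `π`; the `j`-th center comes from the interval `ch j`. -/
structure GreedyInv (α β : ℕ → ℝ) (π : ℕ → ℕ) (n : ℕ) (d : ℝ) (m cnt : ℕ) (out : ℕ → ℝ)
    (ch : ℕ → ℕ) : Prop where
  pierced : ∀ x < m, ∃ j < cnt, α (π x) - d / 2 ≤ out j ∧ out j ≤ β (π x) + d / 2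
  chain : ∀ j < cnt, ch j < n ∧ out j = β (ch j) + d / 2
  gap : ∀ j, j + 1 < cnt → d < α (ch (j + 1)) - β (ch j)
  rest : ∀ j < cnt, ∀ x, m ≤ x → x < n → out j ≤ β (π x) + d / 2

section

variable {α β : ℕ → ℝ} {π : ℕ → ℕ} {n : ℕ} {d : ℝ} {m cnt : ℕ} {out : ℕ → ℝ} {ch : ℕ → ℕ}

/-- All centers lie to the left of the right ends of the remaining enlarged intervals, so comparing
the left end with the last center already decides piercing. -/
theorem GreedyInv.skip (h : GreedyInv α β π n d m cnt out ch) (hm : m < n) (hc : 1 ≤ cnt)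
    (hle : α (π m) ≤ out (cnt - 1) + d / 2) : GreedyInv α β π n d (m + 1) cnt out ch := by
  refine ⟨fun x hx => ?_, h.chain, h.gap, fun j hj x hx => h.rest j hj x (by omega)⟩
  rcases Nat.lt_succ_iff_lt_or_eq.1 hx with hx | rfl
  · exact h.pierced x hx
  · exact ⟨cnt - 1, by omega, by linarith, h.rest _ (by omega) x le_rfl hm⟩

/-- The last center is `β + d / 2` of its interval; if the new enlarged interval starts beyond it,
the gap between the two exceeds `d`, which extends the chain. The order by `β` keeps the new center
left of all later right ends. -/
theorem GreedyInv.push (h : GreedyInv α β π n d m cnt out ch) (hm : m < n) (hπ : SortsBy β n π)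
    (hd : 0 ≤ d) (hab : ∀ i < n, α i ≤ β i)
    (hlt : 1 ≤ cnt → out (cnt - 1) + d / 2 < α (π m)) :
    GreedyInv α β π n d (m + 1) (cnt + 1) (Function.update out cnt (β (π m) + d / 2))
      (Function.update ch cnt (π m)) := by
  have hu : ∀ {γ : Type} (f : ℕ → γ) (v : γ) (j : ℕ), j < cnt → Function.update f cnt v j = f j :=
    fun f v j hj => Function.update_of_ne hj.ne _ _
  have hv := hπ.valid m hm
  refine ⟨fun x hx => ?_, fun j hj => ?_, fun j hj => ?_, fun j hj x hx hxn => ?_⟩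
  · rcases Nat.lt_succ_iff_lt_or_eq.1 hx with hx | rfl
    · obtain ⟨j, hj, hj'⟩ := h.pierced x hx
      exact ⟨j, by omega, by rwa [hu _ _ _ hj]⟩
    · refine ⟨cnt, by omega, ?_⟩
      rw [Function.update_self]
      have := hab _ hv
      exact ⟨by linarith, le_rfl⟩
  · rcases Nat.lt_succ_iff_lt_or_eq.1 hj with hj | rfl
    · rw [hu _ _ _ hj, hu _ _ _ hj]; exact h.chain j hj
    · simp [hv]
  · rw [hu ch _ j (by omega)]
    by_cases hj' : j + 1 = cnt
    · subst hj'
      rw [Function.update_self]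
      have h1 := hlt (by omega)
      have h2 := (h.chain j (by omega)).2
      rw [Nat.add_sub_cancel, h2] at h1
      linarith
    · rw [hu _ _ _ (by omega)]; exact h.gap j (by omega)
  · rcases Nat.lt_succ_iff_lt_or_eq.1 hj with hj | rfl
    · rw [hu _ _ _ hj]; exact h.rest j hj x (by omega) hxn
    · rw [Function.update_self]
      linarith [hπ.sorted m x (by omega) hxn]

end

/-- The centers `out 0, …, out (cnt - 1)` are increasing, pierce all intervals enlarged by `d / 2`,
and there is a chain of as many intervals with gaps greater than `d`. -/
structure GreedySpec (α β : ℕ → ℝ) (n : ℕ) (d : ℝ) (cnt : ℕ) (out : ℕ → ℝ) : Prop where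
  increasing : ∀ j, j + 1 < cnt → out j < out (j + 1)
  pierced : ∀ i < n, ∃ j < cnt, α i - d / 2 ≤ out j ∧ out j ≤ β i + d / 2
  chain : GapChain α β n cnt (d < ·)

theorem GreedyInv.spec {α β : ℕ → ℝ} {π : ℕ → ℕ} {n : ℕ} {d : ℝ} {cnt : ℕ} {out : ℕ → ℝ}
    {ch : ℕ → ℕ} (h : GreedyInv α β π n d n cnt out ch) (hπ : SortsBy β n π)
    (hd : 0 ≤ d) (hab : ∀ i < n, α i ≤ β i) : GreedySpec α β n d cnt out := by
  refine ⟨fun j hj => ?_, fun i hi => ?_, ch, fun j hj => (h.chain j hj).1, h.gap⟩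
  · rw [(h.chain j (by omega)).2, (h.chain (j + 1) hj).2]
    linarith [h.gap j hj, hab _ (h.chain (j + 1) hj).1]
  · obtain ⟨x, hx, rfl⟩ := hπ.surj i hi
    exact h.pierced x hx

theorem wp_greedy {s : State} {n : ℕ} {d : ℝ} (hn : s.nat 0 0 = n) (hdef : s.real 6 0 = d)
    (hπ : SortsBy (s.real 1) n (s.nat 3)) (hd : 0 ≤ d) (hab : ∀ i < n, s.real 0 i ≤ s.real 1 i) :
    wp greedy s fun t s' => t ≤ 60 * n + 20 ∧ (∀ y, y ≠ 10 → y ≠ 11 → s'.nat y = s.nat y) ∧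
      (∀ y, y ≠ 2 → s'.real y = s.real y) ∧
      GreedySpec (s.real 0) (s.real 1) n d (s'.nat 11 0) (s'.real 2) := by
  refine wp_seq (wp_setNat (wp_seq (wp_setNat ?_)))
  refine wp_loop (fun φ s' => (∀ y, y ≠ 10 → y ≠ 11 → s'.nat y = s.nat y) ∧
      (∀ y, y ≠ 2 → s'.real y = s.real y) ∧ φ = 60 * (n - s'.nat 10 0) ∧ s'.nat 10 0 ≤ n ∧
      ∃ ch, GreedyInv (s.real 0) (s.real 1) (s.nat 3) n d (s'.nat 10 0) (s'.nat 11 0)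
        (s'.real 2) ch) ?_ (φ := 60 * n) ?_ ?_
  · rintro φ s' ⟨hf, hr, rfl, -, ch, hI⟩ ht
    have e0 : s'.nat 0 0 = n := by rw [hf 0 (by norm_num) (by norm_num), hn]
    have e1 : s'.nat 3 = s.nat 3 := hf 3 (by norm_num) (by norm_num)
    have e2 : s'.real 0 = s.real 0 := hr 0 (by norm_num)
    have e3 : s'.real 1 = s.real 1 := hr 1 (by norm_num)
    have e4 : s'.real 6 0 = d := by rw [hr 6 (by norm_num), hdef]
    simp [e0] at ht
    refine wp_seq (wp_branch (fun hb => ?_) (fun hb => ?_))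
    · simp [e1, e2, e4] at hb
      refine wp_skip (wp_setNat ⟨_, ⟨?_, ?_, rfl, ?_, ch, ?_⟩, ?_⟩)
      · intro y hy hy'
        simp [*]
      · simpa using hr
      · simpa using ht
      · simpa using hI.skip (by omega) hb.1 hb.2
      · simp
        omega
    · simp [e1, e2, e4] at hb
      refine wp_seq (wp_setReal (wp_setNat (wp_setNat ⟨_, ⟨?_, ?_, rfl, ?_,
        Function.update ch (s'.nat 11 0) (s.nat 3 (s'.nat 10 0)), ?_⟩, ?_⟩)))
      · intro y hy hy'
        simp [*]
      · intro y hy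
        simp [*]
      · simpa using ht
      · simpa [e1, e3, e4] using hI.push (by omega) hπ hd hab hb
      · simp
        omega
  · refine ⟨?_, ?_, ?_, ?_, fun _ => 0, ?_⟩
    · intro y hy hy'
      simp [*]
    · simp
    · simp
    · simp
    · constructor <;> simp
  · rintro t φ' s' ⟨hf, hr, rfl, hm, ch, hI⟩ ht hle
    have e0 : s'.nat 0 0 = n := by rw [hf 0 (by norm_num) (by norm_num), hn]
    simp [e0] at ht hle
    have : s'.nat 10 0 = n := by omega
    rw [this] at hI
    exact ⟨by simp; omega, hf, hr, hI.spec hπ hd hab⟩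

/-! ### The gap matrix and the staircase walk that lists its entries between two bounds. -/

/-- The gap from the interval with the `σ * x`-th right endpoint to that with the `σ * y`-th left
endpoint. -/
def gap (A B : ℕ → ℝ) (σ x y : ℕ) : ℝ := A (σ * y) - B (σ * x)

/-- The index pairs whose gap lies strictly between `lo` and `hi`. -/
noncomputable def window (A B : ℕ → ℝ) (σ m : ℕ) (lo hi : ℝ) : Finset (ℕ × ℕ) :=
  (Finset.range m ×ˢ Finset.range m).filter fun z =>
    lo < gap A B σ z.1 z.2 ∧ gap A B σ z.1 z.2 < hi

theorem mem_window {A B : ℕ → ℝ} {σ m : ℕ} {lo hi : ℝ} {x y : ℕ} :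
    (x, y) ∈ window A B σ m lo hi ↔
      (x < m ∧ y < m) ∧ lo < gap A B σ x y ∧ gap A B σ x y < hi := by
  simp [window]

/-- The pairs before `(x, y)` in the row by row order of the square with side `m`. -/
def before (m x y : ℕ) : Set (ℕ × ℕ) :=
  {z | z.1 < m ∧ z.2 < m ∧ (z.1 < x ∨ z.1 = x ∧ z.2 < y)}

/-- `C 0, …, C (N - 1)` lists the gaps between `lo` and `hi` of the pairs in `Z`; the `r`-th is the
gap of the pair `f r`. -/
structure Lists (v : ℕ → ℕ → ℝ) (lo hi : ℝ) (Z : Set (ℕ × ℕ)) (N : ℕ) (C : ℕ → ℝ)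
    (f : ℕ → ℕ × ℕ) : Prop where
  mem : ∀ r < N, f r ∈ Z
  eq : ∀ r < N, C r = v (f r).1 (f r).2
  bounds : ∀ r < N, lo < C r ∧ C r < hi
  inj : ∀ r < N, ∀ r' < N, f r = f r' → r = r'
  surj : ∀ x y, (x, y) ∈ Z → lo < v x y → v x y < hi → ∃ r < N, f r = (x, y)

/-- Listed pairs are distinct members of the window. This bounds the length of the list and makes
window size minus length a valid potential for `scan`. -/
theorem Lists.le_card {A B : ℕ → ℝ} {σ m : ℕ} {lo hi : ℝ} {Z : Set (ℕ × ℕ)} {N : ℕ} {C : ℕ → ℝ}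
    {f : ℕ → ℕ × ℕ} (h : Lists (gap A B σ) lo hi Z N C f) (hZ : ∀ z ∈ Z, z.1 < m ∧ z.2 < m) :
    N ≤ (window A B σ m lo hi).card := by
  have := Finset.card_le_card_of_injOn (s := Finset.range N) (t := window A B σ m lo hi) f
    (fun r hr => by
      have hr := Finset.mem_range.1 hr
      have h1 := h.bounds r hr
      rw [h.eq r hr] at h1
      exact mem_window.2 ⟨hZ _ (h.mem r hr), h1⟩)
    (fun r hr r' hr' => h.inj r (by simpa using hr) r' (by simpa using hr'))
  simpa using this

section

variable {v : ℕ → ℕ → ℝ} {lo hi : ℝ} {N : ℕ} {C : ℕ → ℝ} {f : ℕ → ℕ × ℕ}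

/-- The visited region may grow for free over cells whose gaps are outside the bounds; this accounts
for the cells that the walk skips. -/
theorem Lists.extend {Z Z' : Set (ℕ × ℕ)} (h : Lists v lo hi Z N C f) (hZ : Z ⊆ Z')
    (hno : ∀ x y, (x, y) ∈ Z' → (x, y) ∉ Z → v x y ≤ lo ∨ hi ≤ v x y) :
    Lists v lo hi Z' N C f := by
  refine ⟨fun r hr => hZ (h.mem r hr), h.eq, h.bounds, h.inj, fun x y hz h1 h2 => ?_⟩
  by_cases hzz : (x, y) ∈ Z
  · exact h.surj x y hzz h1 h2
  · rcases hno x y hz hzz with h3 | h3 <;> linarith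

theorem Lists.push {m x y : ℕ} (h : Lists v lo hi (before m x y) N C f) (hx : x < m) (hy : y < m)
    (h1 : lo < v x y) (h2 : v x y < hi) :
    Lists v lo hi (before m x (y + 1)) (N + 1) (Function.update C N (v x y))
      (Function.update f N (x, y)) := by
  have hu : ∀ {γ : Type} (g : ℕ → γ) (w : γ) (j : ℕ), j < N → Function.update g N w j = g j :=
    fun g w j hj => Function.update_of_ne hj.ne _ _
  have hsub : before m x y ⊆ before m x (y + 1) := by
    rintro z ⟨z1, z2, z3⟩
    exact ⟨z1, z2, by omega⟩
  have hnew : ∀ r < N, f r ≠ (x, y) := by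
    intro r hr he
    have := h.mem r hr
    rw [he] at this
    obtain ⟨-, -, h3⟩ := this
    simp at h3
  refine ⟨fun r hr => ?_, fun r hr => ?_, fun r hr => ?_, fun r hr r' hr' he => ?_,
    fun x' y' hz h1' h2' => ?_⟩
  · rcases Nat.lt_succ_iff_lt_or_eq.1 hr with hr | rfl
    · rw [hu _ _ _ hr]; exact hsub (h.mem r hr)
    · rw [Function.update_self]
      exact ⟨hx, hy, Or.inr ⟨rfl, Nat.lt_succ_self y⟩⟩
  · rcases Nat.lt_succ_iff_lt_or_eq.1 hr with hr | rfl
    · rw [hu _ _ _ hr, hu _ _ _ hr]; exact h.eq r hr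
    · simp
  · rcases Nat.lt_succ_iff_lt_or_eq.1 hr with hr | rfl
    · rw [hu _ _ _ hr]; exact h.bounds r hr
    · simp [h1, h2]
  · rcases Nat.lt_succ_iff_lt_or_eq.1 hr with hr | rfl <;>
      rcases Nat.lt_succ_iff_lt_or_eq.1 hr' with hr' | rfl
    · rw [hu _ _ _ hr, hu _ _ _ hr'] at he; exact h.inj r hr r' hr' he
    · rw [hu _ _ _ hr, Function.update_self] at he; exact absurd he (hnew r hr)
    · rw [hu _ _ _ hr', Function.update_self] at he; exact absurd he.symm (hnew r' hr')
    · rfl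
  · by_cases hz' : (x', y') ∈ before m x y
    · obtain ⟨r, hr, hr'⟩ := h.surj x' y' hz' h1' h2'
      exact ⟨r, by omega, by rw [hu _ _ _ hr, hr']⟩
    · refine ⟨N, by omega, ?_⟩
      simp only [before, Set.mem_ofPred_eq] at hz hz'
      rw [Function.update_self, Prod.mk.injEq]
      omega

end

/-- The fixed data in the memory while gaps are collected: `n`, the stride `σ`, the sorted left and
right endpoints `A` and `B`, and the bounds `lo` and `hi`. -/
structure CollectCtx (s : State) (n σ : ℕ) (A B : ℕ → ℝ) (lo hi : ℝ) : Prop where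
  n_eq : s.nat 0 0 = n
  σ_eq : s.nat 5 0 = σ
  A_eq : ∀ y, s.real 0 (s.nat 2 y) = A y
  B_eq : ∀ x, s.real 1 (s.nat 3 x) = B x
  lo_eq : s.real 4 0 = lo
  hi_eq : s.real 5 0 = hi

theorem CollectCtx.frame {s s' : State} {n σ : ℕ} {A B : ℕ → ℝ} {lo hi : ℝ}
    (h : CollectCtx s n σ A B lo hi) (hf : ∀ y < 8, s'.nat y = s.nat y)
    (hr : ∀ y, y ≠ 3 → s'.real y = s.real y) : CollectCtx s' n σ A B lo hi := by
  refine ⟨?_, ?_, fun y => ?_, fun x => ?_, ?_, ?_⟩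
  · rw [hf 0 (by norm_num), h.n_eq]
  · rw [hf 5 (by norm_num), h.σ_eq]
  · rw [hf 2 (by norm_num), hr 0 (by norm_num), h.A_eq]
  · rw [hf 3 (by norm_num), hr 1 (by norm_num), h.B_eq]
  · rw [hr 4 (by norm_num), h.lo_eq]
  · rw [hr 5 (by norm_num), h.hi_eq]

/-- Advance the index in variable 13 to the first gap greater than `lo` in the row of variable 12. -/
def advance : Program :=
  .loop (.conj (natLt (nv 13) (nv 0))
    (.realLe (.get 0 (.get 2 (nv 13))) (.add (.get 1 (.get 3 (nv 12))) (rv 4)))) <|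
  .setNat 13 (.lit 0) (.add (nv 13) (nv 5))

/-- Amortized cost: 40 for each column passed, plus a constant. The column pointer is not reset
between rows, so over all rows these steps total `O(m)`. -/
theorem wp_advance {s : State} {n σ m x y : ℕ} {A B : ℕ → ℝ} {lo hi : ℝ}
    (hs : CollectCtx s n σ A B lo hi) (hm : ∀ x, σ * x < n ↔ x < m)
    (hi' : s.nat 12 0 = σ * x) (hq : s.nat 13 0 = σ * y) (hy : y ≤ m)
    (hlo : ∀ y' < y, gap A B σ x y' ≤ lo) :
    wp advance s fun t s' => ∃ y₁, t + 40 * (m - y₁) ≤ 40 * (m - y) + 40 ∧ y₁ ≤ m ∧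
      s'.real = s.real ∧ (∀ z, z ≠ 13 → s'.nat z = s.nat z) ∧ s'.nat 13 0 = σ * y₁ ∧
      (∀ y' < y₁, gap A B σ x y' ≤ lo) ∧ (y₁ < m → lo < gap A B σ x y₁) := by
  refine wp_loop (fun φ s' => ∃ y₁, φ = 40 * (m - y₁) ∧ y₁ ≤ m ∧
      s'.real = s.real ∧ (∀ z, z ≠ 13 → s'.nat z = s.nat z) ∧ s'.nat 13 0 = σ * y₁ ∧
      (∀ y' < y₁, gap A B σ x y' ≤ lo)) ?_ (φ := 40 * (m - y))
      ⟨y, rfl, hy, rfl, fun _ _ => rfl, hq, hlo⟩ ?_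
  · rintro φ s' ⟨y₁, rfl, h1, h2, h3, h4, h5⟩ ht
    have hs' := hs.frame (s' := s') (fun z hz => h3 z (by omega)) (fun z _ => by rw [h2])
    have hi₂ : s'.nat 12 0 = σ * x := by rw [h3 12 (by norm_num), hi']
    simp [hs'.n_eq, hs'.A_eq, hs'.B_eq, hs'.lo_eq, hi₂, h4] at ht
    have hlt : y₁ < m := (hm _).1 (by omega)
    refine wp_setNat ⟨_, ⟨y₁ + 1, rfl, hlt, h2, ?_, ?_, ?_⟩, ?_⟩
    · intro z hz
      simp [*]
    · simp [h4, hs'.σ_eq]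
      ring
    · intro y' hy'
      rcases Nat.lt_succ_iff_lt_or_eq.1 hy' with hy' | rfl
      · exact h5 _ hy'
      · unfold gap; linarith [ht.2]
    · simp
      omega
  · rintro t φ' s' ⟨y₁, rfl, h1, h2, h3, h4, h5⟩ ht hle
    have hs' := hs.frame (s' := s') (fun z hz => h3 z (by omega)) (fun z _ => by rw [h2])
    have hi₂ : s'.nat 12 0 = σ * x := by rw [h3 12 (by norm_num), hi']
    simp [hs'.n_eq, hs'.A_eq, hs'.B_eq, hs'.lo_eq, hi₂, h4] at ht hle
    refine ⟨y₁, by omega, h1, h2, h3, h4, h5, fun hy₁ => ?_⟩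
    have := ht ((hm _).2 hy₁)
    unfold gap; linarith

/-- Append to the real array 3 the gaps less than `hi` in the row of variable 12, starting at the
index in variable 14. -/
def scan : Program :=
  .loop (.conj (natLt (nv 14) (nv 0))
    (.neg (.realLe (.add (.get 1 (.get 3 (nv 12))) (rv 5)) (.get 0 (.get 2 (nv 14)))))) <|
  .seq (.setReal 3 (nv 8) (.sub (.get 0 (.get 2 (nv 14))) (.get 1 (.get 3 (nv 12))))) <|
  .seq (.setNat 8 (.lit 0) (.add (nv 8) (.lit 1))) <|
  .setNat 14 (.lit 0) (.add (nv 14) (nv 5))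

/-- Every iteration appends a gap, so the cost is charged to the part of the window not yet listed.
-/
theorem wp_scan {s : State} {n σ m x y : ℕ} {A B : ℕ → ℝ} {lo hi : ℝ} {f : ℕ → ℕ × ℕ}
    (hs : CollectCtx s n σ A B lo hi) (hm : ∀ x, σ * x < n ↔ x < m)
    (hA : ∀ i j, i ≤ j → j < n → A i ≤ A j)
    (hi' : s.nat 12 0 = σ * x) (hq : s.nat 14 0 = σ * y) (hx : x < m) (hy : y ≤ m)
    (hlo : ∀ y', y ≤ y' → y' < m → lo < gap A B σ x y')
    (hf : Lists (gap A B σ) lo hi (before m x y) (s.nat 8 0) (s.real 3) f) :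
    wp scan s fun t s' =>
      t + 60 * ((window A B σ m lo hi).card - s'.nat 8 0) ≤
        60 * ((window A B σ m lo hi).card - s.nat 8 0) + 60 ∧
      (∀ z, z ≠ 3 → s'.real z = s.real z) ∧ (∀ z, z ≠ 8 → z ≠ 14 → s'.nat z = s.nat z) ∧
      ∃ f, Lists (gap A B σ) lo hi (before m (x + 1) 0) (s'.nat 8 0) (s'.real 3) f := by
  refine wp_loop (fun φ s' => ∃ y₁ f, φ = 60 * ((window A B σ m lo hi).card - s'.nat 8 0) ∧
      y ≤ y₁ ∧ y₁ ≤ m ∧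
      (∀ z, z ≠ 3 → s'.real z = s.real z) ∧ (∀ z, z ≠ 8 → z ≠ 14 → s'.nat z = s.nat z) ∧
      s'.nat 14 0 = σ * y₁ ∧
      Lists (gap A B σ) lo hi (before m x y₁) (s'.nat 8 0) (s'.real 3) f) ?_
      ⟨y, f, rfl, le_rfl, hy, fun _ _ => rfl, fun _ _ _ => rfl, hq, hf⟩ ?_
  · rintro φ s' ⟨y₁, f, rfl, h1, h2, h3, h4, h5, h6⟩ ht
    have hs' := hs.frame (s' := s') (fun z hz => h4 z (by omega) (by omega)) h3
    have hi₂ : s'.nat 12 0 = σ * x := by rw [h4 12 (by norm_num) (by norm_num), hi']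
    simp [hs'.n_eq, hs'.A_eq, hs'.B_eq, hs'.hi_eq, hi₂, h5] at ht
    have hlt : y₁ < m := (hm _).1 (by omega)
    have h7 := h6.push hx hlt (hlo _ h1 hlt) (by unfold gap; linarith [ht.2])
    have h8 := h7.le_card (m := m) fun z hz => ⟨hz.1, hz.2.1⟩
    refine wp_seq (wp_setReal (wp_seq (wp_setNat (wp_setNat
      ⟨_, ⟨y₁ + 1, Function.update f (s'.nat 8 0) (x, y₁), rfl, by omega, hlt, ?_, ?_, ?_, ?_⟩,
        ?_⟩))))
    rotate_left 3
    · simpa [hs'.A_eq, hs'.B_eq, hi₂, h5, gap] using h7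
    · simp
      omega
    · intro z hz
      simp [*]
    · intro z hz hz'
      simp [*]
    · simp [h5, hs'.σ_eq]
      ring
  · rintro t φ' s' ⟨y₁, f, rfl, h1, h2, h3, h4, h5, h6⟩ ht hle
    have hs' := hs.frame (s' := s') (fun z hz => h4 z (by omega) (by omega)) h3
    have hi₂ : s'.nat 12 0 = σ * x := by rw [h4 12 (by norm_num) (by norm_num), hi']
    simp [hs'.n_eq, hs'.A_eq, hs'.B_eq, hs'.hi_eq, hi₂, h5] at ht hle
    refine ⟨by omega, h3, h4, f, h6.extend ?_ ?_⟩
    · rintro z ⟨z1, z2, z3⟩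
      exact ⟨z1, z2, by omega⟩
    · intro x' y' hz hz'
      simp only [before, Set.mem_ofPred_eq] at hz hz'
      obtain rfl : x' = x := by omega
      have h9 : y₁ ≤ y' := by omega
      have := ht ((hm _).2 (by omega))
      -- Gaps increase along a row: once one reaches `hi`, so do all later ones.
      have := hA (σ * y₁) (σ * y') (Nat.mul_le_mul_left _ h9) ((hm _).2 hz.2.1)
      right
      unfold gap; linarith

/-- List the gaps between the bounds `lo` and `hi`, for the indices that are multiples of `σ`, in
the real array 3. -/
def collect : Program :=
  .seq (.setNat 8 (.lit 0) (.lit 0)) <|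
  .seq (.setNat 12 (.lit 0) (.lit 0)) <|
  .seq (.setNat 13 (.lit 0) (.lit 0)) <|
  .loop (natLt (nv 12) (nv 0)) <|
  .seq advance <|
  .seq (.setNat 14 (.lit 0) (nv 13)) <|
  .seq scan <|
  .setNat 12 (.lit 0) (.add (nv 12) (nv 5))

theorem wp_collect {s : State} {n σ m : ℕ} {A B : ℕ → ℝ} {lo hi : ℝ}
    (hs : CollectCtx s n σ A B lo hi) (hm : ∀ x, σ * x < n ↔ x < m)
    (hA : ∀ i j, i ≤ j → j < n → A i ≤ A j) (hB : ∀ i j, i ≤ j → j < n → B i ≤ B j) :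
    wp collect s fun t s' =>
      t ≤ 240 * m + 60 * (window A B σ m lo hi).card + 50 ∧
      (∀ z, z ≠ 3 → s'.real z = s.real z) ∧ (∀ z < 8, s'.nat z = s.nat z) ∧
      ∃ f, Lists (gap A B σ) lo hi (before m m 0) (s'.nat 8 0) (s'.real 3) f := by
  refine wp_seq (wp_setNat (wp_seq (wp_setNat (wp_seq (wp_setNat ?_)))))
  refine wp_loop (fun φ s' => ∃ x y f, φ = 200 * (m - x) + 40 * (m - y) +
        60 * ((window A B σ m lo hi).card - s'.nat 8 0) ∧
      x ≤ m ∧ y ≤ m ∧ s'.nat 12 0 = σ * x ∧ s'.nat 13 0 = σ * y ∧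
      (∀ z, z ≠ 3 → s'.real z = s.real z) ∧ (∀ z < 8, s'.nat z = s.nat z) ∧
      (x < m → ∀ y' < y, gap A B σ x y' ≤ lo) ∧
      Lists (gap A B σ) lo hi (before m x 0) (s'.nat 8 0) (s'.real 3) f) ?_
      (φ := 200 * m + 40 * m + 60 * (window A B σ m lo hi).card) ?_ ?_
  · rintro φ s' ⟨x, y, f, rfl, h1, h2, h3, h4, h5, h6, h7, h8⟩ ht
    have hs' := hs.frame (s' := s') h6 h5
    simp [hs'.n_eq, h3] at ht
    have hx : x < m := (hm x).1 ht
    refine wp_seq (wp_mono (wp_advance hs' hm h3 h4 h2 (h7 hx)) ?_)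
    rintro t s₁ ⟨y₁, i1, i2, i3, i4, i5, i6, i7⟩
    refine wp_seq (wp_setNat (wp_seq ?_))
    have hs₁ := hs'.frame (s' := s₁) (fun z hz => i4 z (by omega)) (fun z _ => by rw [i3])
    have hs₂ : CollectCtx (s₁.setNat 14 0 (s₁.nat 13 0)) n σ A B lo hi :=
      hs₁.frame (fun z hz => State.nat_setNat_ne _ _ _ (by omega)) fun _ _ => rfl
    have hmono : ∀ y', y₁ ≤ y' → y' < m → lo < gap A B σ x y' := by
      intro y' hy' hym
      have := i7 (by omega)
      have := hA (σ * y₁) (σ * y') (Nat.mul_le_mul_left _ hy') ((hm _).2 hym)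
      unfold gap at *; linarith
    refine wp_mono (wp_scan hs₂ hm hA (x := x) (y := y₁) (f := f) ?_ ?_ hx i2 hmono ?_) ?_
    · simpa [i4] using h3
    · simpa using i5
    · have : s₁.nat 8 = s'.nat 8 := i4 8 (by norm_num)
      simp only [State.real_setNat, i3, this, ne_eq, Nat.reduceEqDiff, not_false_eq_true,
        State.nat_setNat_ne]
      refine h8.extend ?_ ?_
      · rintro z ⟨z1, z2, z3⟩
        exact ⟨z1, z2, by omega⟩
      · intro x' y' hz hz'
        simp only [before, Set.mem_ofPred_eq] at hz hz'
        obtain rfl : x' = x := by omega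
        exact Or.inl (i6 y' (by omega))
    · rintro t' s₃ ⟨j1, j2, j3, f', j4⟩
      have e8 : s₁.nat 8 = s'.nat 8 := i4 8 (by norm_num)
      have e12 : s₃.nat 12 0 = σ * x := by
        rw [j3 12 (by norm_num) (by norm_num)]; simpa [i4] using h3
      have e13 : s₃.nat 13 0 = σ * y₁ := by
        rw [j3 13 (by norm_num) (by norm_num)]; simpa using i5
      have e5 : s₃.nat 5 0 = σ := by
        rw [j3 5 (by norm_num) (by norm_num)]; simpa using hs₁.σ_eq
      simp [e8] at j1
      refine wp_setNat ⟨_, ⟨x + 1, y₁, f', rfl, hx, i2, ?_, ?_, ?_, ?_, ?_, ?_⟩, ?_⟩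
      · simp [e12, e5]; ring
      · simp [e13]
      · intro z hz
        rw [State.real_setNat, j2 z hz, State.real_setNat, i3, h5 z hz]
      · intro z hz
        rw [State.nat_setNat_ne _ _ _ (by omega), j3 z (by omega) (by omega),
          State.nat_setNat_ne _ _ _ (by omega), i4 z (by omega), h6 z hz]
      · intro hx' y' hy'
        have := i6 y' hy'
        -- Gaps decrease from row to row, so the columns skipped in row `x` can also be skipped in
        -- row `x + 1`. Monotonicity of `B` is known only below `n`, hence the guard `x < m` in the
        -- invariant.
        have := hB (σ * x) (σ * (x + 1)) (Nat.mul_le_mul_left _ (Nat.le_succ x)) ((hm _).2 hx')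
        unfold gap at *; linarith
      · simpa using j4
      · simp
        omega
  · refine ⟨0, 0, fun _ => 0, ?_, by simp, by simp, by simp, by simp, fun _ _ => rfl, ?_, ?_, ?_⟩
    · simp
    · intro z hz
      have : z ≠ 8 := by omega
      have : z ≠ 12 := by omega
      have : z ≠ 13 := by omega
      simp [*]
    · simp
    · simp only [NatExpr.eval, ne_eq, Nat.reduceEqDiff, not_false_eq_true, State.nat_setNat_ne,
        State.nat_setNat_self, Function.update_self]
      constructor <;> simp [before]
  · rintro t φ' s' ⟨x, y, f, rfl, h1, h2, h3, h4, h5, h6, h7, h8⟩ ht hle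
    have hs' := hs.frame (s' := s') h6 h5
    simp [hs'.n_eq, h3] at ht hle
    have hx : ¬ x < m := fun h => absurd ((hm x).2 h) (by omega)
    obtain rfl : x = m := by omega
    exact ⟨by simp; omega, h5, h6, f, h8⟩

/-! ### Refining the grid: how many gaps appear between the bounds. -/

/-- Halving the stride multiplies the number of gaps between two bounds at most by four, up to a
term linear in the number of rows. -/
theorem card_window_le {A B : ℕ → ℝ} {n σ m m' : ℕ} {lo hi : ℝ}
    (hm : ∀ x, 2 * σ * x < n ↔ x < m) (hm' : ∀ x, σ * x < n ↔ x < m')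
    (hA : ∀ i j, i ≤ j → j < n → A i ≤ A j) (hB : ∀ i j, i ≤ j → j < n → B i ≤ B j) :
    (window A B σ m' lo hi).card ≤ 4 * (window A B (2 * σ) m lo hi).card + 8 * m := by
  set W := window A B σ m' lo hi with hW
  set g : ℕ × ℕ → ℕ × ℕ := fun z => (z.1 / 2, z.2 / 2) with hg
  have hσ : ∀ {x y : ℕ}, x ≤ 2 * y → σ * x ≤ 2 * σ * y := fun {x y} h => by
    calc σ * x ≤ σ * (2 * y) := Nat.mul_le_mul_left _ h
      _ = 2 * σ * y := by ring
  have hσ' : ∀ {x y : ℕ}, 2 * x ≤ y → 2 * σ * x ≤ σ * y := fun {x y} h => by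
    calc 2 * σ * x = σ * (2 * x) := by ring
      _ ≤ σ * y := Nat.mul_le_mul_left _ h
  have hhalf : ∀ x, x < m' → x / 2 < m := fun x hx =>
    (hm _).1 (lt_of_le_of_lt (hσ' (by omega)) ((hm' x).2 hx))
  -- Halving both indices maps fine cells to coarse cells, with at most four over each.
  have h1 : W.card ≤ 4 * (W.image g).card := by
    refine Finset.card_le_mul_card_image W 4 fun z _ => ?_
    have : (W.filter fun w => g w = z) ⊆
        ({2 * z.1, 2 * z.1 + 1} : Finset ℕ) ×ˢ ({2 * z.2, 2 * z.2 + 1} : Finset ℕ) := by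
      intro w hw
      obtain ⟨-, rfl⟩ := Finset.mem_filter.1 hw
      simp only [hg, Finset.mem_product, Finset.mem_insert, Finset.mem_singleton]
      omega
    refine (Finset.card_le_card this).trans ?_
    rw [Finset.card_product]
    exact Nat.mul_le_mul Finset.card_le_two Finset.card_le_two
  -- A coarse cell of the image whose own gap is outside the bounds lies in `E₁` or `E₂`, the cells
  -- on the two boundaries of the staircase region.
  set E₁ := (W.image g).filter fun z => gap A B (2 * σ) z.1 z.2 ≤ lo with hE₁
  set E₂ := (W.image g).filter fun z => hi ≤ gap A B (2 * σ) z.1 z.2 with hE₂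
  have hlt : ∀ z ∈ W.image g, z.1 < m ∧ z.2 < m := by
    intro z hz
    obtain ⟨⟨x, y⟩, hw, rfl⟩ := Finset.mem_image.1 hz
    have := (mem_window.1 hw).1
    exact ⟨hhalf _ this.1, hhalf _ this.2⟩
  have h2 : W.image g ⊆ window A B (2 * σ) m lo hi ∪ (E₁ ∪ E₂) := by
    rintro ⟨x, y⟩ hz
    simp only [Finset.mem_union, hE₁, hE₂, Finset.mem_filter, mem_window]
    rcases le_or_gt (gap A B (2 * σ) x y) lo with h | h
    · exact Or.inr (Or.inl ⟨hz, h⟩)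
    · rcases le_or_gt hi (gap A B (2 * σ) x y) with h' | h'
      · exact Or.inr (Or.inr ⟨hz, h'⟩)
      · exact Or.inl ⟨hlt _ hz, h, h'⟩
  have h3 : E₁.card ≤ m := by
    have := Finset.card_le_card_of_injOn (s := E₁) (t := Finset.range m) Prod.fst
      (fun z hz => Finset.mem_coe.2 (Finset.mem_range.2 (hlt z (Finset.mem_filter.1 hz).1).1)) ?_
    · simpa using this
    -- Each row meets `E₁` at most once: for `Y < Y'` a fine cell over `(X, Y)` comes before column
    -- `2 * Y'` and not before row `2 * X`, so its gap is at most that of `(X, Y')`, hence at most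
    -- `lo`.
    have key : ∀ X Y Y', (X, Y) ∈ E₁ → (X, Y') ∈ E₁ → ¬ Y < Y' := by
      intro X Y Y' h h' hYY
      obtain ⟨hz, -⟩ := Finset.mem_filter.1 h
      obtain ⟨hz', hle⟩ := Finset.mem_filter.1 h'
      have hlt' := hlt _ hz'
      obtain ⟨⟨x, y⟩, hw, he⟩ := Finset.mem_image.1 hz
      obtain ⟨⟨hx, hy⟩, hlo, -⟩ := mem_window.1 hw
      simp only [hg, Prod.mk.injEq] at he
      have i1 := hA (σ * y) (2 * σ * Y') (hσ (by omega)) ((hm _).2 hlt'.2)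
      have i2 := hB (2 * σ * X) (σ * x) (hσ' (by omega)) ((hm' _).2 hx)
      simp only [gap] at hlo hle
      linarith
    rintro ⟨X, Y⟩ h ⟨X', Y'⟩ h' he
    obtain rfl : X = X' := he
    have := key X Y Y' h h'
    have := key X Y' Y h' h
    rw [Prod.mk.injEq]
    omega
  have h4 : E₂.card ≤ m := by
    have := Finset.card_le_card_of_injOn (s := E₂) (t := Finset.range m) Prod.snd
      (fun z hz => Finset.mem_coe.2 (Finset.mem_range.2 (hlt z (Finset.mem_filter.1 hz).1).2)) ?_
    · simpa using this
    -- Dually, each column meets `E₂` at most once: a fine cell over `(X, Y)` with `X < X'` would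
    -- have a gap at least that of `(X', Y)`, hence at least `hi`.
    have key : ∀ X X' Y, (X, Y) ∈ E₂ → (X', Y) ∈ E₂ → ¬ X < X' := by
      intro X X' Y h h' hXX
      obtain ⟨hz, -⟩ := Finset.mem_filter.1 h
      obtain ⟨hz', hle⟩ := Finset.mem_filter.1 h'
      have hlt' := hlt _ hz'
      obtain ⟨⟨x, y⟩, hw, he⟩ := Finset.mem_image.1 hz
      obtain ⟨⟨hx, hy⟩, -, hhi⟩ := mem_window.1 hw
      simp only [hg, Prod.mk.injEq] at he
      have i1 := hB (σ * x) (2 * σ * X') (hσ (by omega)) ((hm _).2 hlt'.1)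
      have i2 := hA (2 * σ * Y) (σ * y) (hσ' (by omega)) ((hm' _).2 hy)
      simp only [gap] at hhi hle
      linarith
    rintro ⟨X, Y⟩ h ⟨X', Y'⟩ h' he
    obtain rfl : Y = Y' := he
    have := key X X' Y h h'
    have := key X' X Y h' h
    rw [Prod.mk.injEq]
    omega
  have h5 := (Finset.card_le_card h2).trans (Finset.card_union_le _ _)
  have h6 := Finset.card_union_le E₁ E₂
  omega

/-! ### Bisection with the greedy test. -/

/-- One step of binary search in the sorted list of gaps: test the gap in the middle. -/
def bisect : Program :=
  .branch (natLt (nv 6) (nv 7))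
    (.seq (.setNat 9 (.lit 0) (.half (.add (nv 6) (nv 7)))) <|
     .seq (.setReal 6 (.lit 0) (.get 3 (.get 4 (nv 9)))) <|
     .seq greedy <|
     .branch (.natLe (nv 11) (nv 1))
      (.seq (.setReal 5 (.lit 0) (rv 6)) (.setNat 7 (.lit 0) (nv 9)))
      (.seq (.setReal 4 (.lit 0) (rv 6)) (.setNat 6 (.lit 0) (.add (nv 9) (.lit 1)))))
    .skip

/-- The state of the search for the optimal radius: the intervals, sorted in both ways, a lower
bound `lo` for which `k` centers are not enough, and an upper bound `hi` for which they are. -/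
structure SearchInv (s : State) (α β : ℕ → ℝ) (πA πB : ℕ → ℕ) (n k : ℕ) : Prop where
  n_eq : s.nat 0 0 = n
  k_eq : s.nat 1 0 = k
  πA_eq : s.nat 2 = πA
  πB_eq : s.nat 3 = πB
  α_eq : s.real 0 = α
  β_eq : s.real 1 = β
  nonneg : 0 ≤ s.real 4 0
  chain : GapChain α β n (k + 1) (s.real 4 0 < ·)
  cover : 0 ≤ s.real 5 0 ∧ ∃ S : Finset ℝ, S.card ≤ k ∧ Pierces α β n (s.real 5 0) S

/-- The gaps between the bounds, for the stride `σ`, are among the entries between variables 6 and 7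
of the sorted list of gaps; the `z`-th of this list is the gap of the pair `g z`. -/
structure Listed (s : State) (A B : ℕ → ℝ) (σ m : ℕ) (g : ℕ → ℕ × ℕ) : Prop where
  bounds : ∀ z, s.nat 6 0 ≤ z → z < s.nat 7 0 →
    s.real 4 0 ≤ s.real 3 (s.nat 4 z) ∧ s.real 3 (s.nat 4 z) ≤ s.real 5 0
  sorted : ∀ z z', z ≤ z' → z' < s.nat 7 0 → s.real 3 (s.nat 4 z) ≤ s.real 3 (s.nat 4 z')
  eq : ∀ z < s.nat 7 0, s.real 3 (s.nat 4 z) = gap A B σ (g z).1 (g z).2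
  mem : ∀ x y, (x, y) ∈ window A B σ m (s.real 4 0) (s.real 5 0) →
    ∃ z, s.nat 6 0 ≤ z ∧ z < s.nat 7 0 ∧ g z = (x, y)

/-- The window lies in the image of the remaining positions under `g`, so injectivity of `g` is not
needed. -/
theorem Listed.card_le {s : State} {A B : ℕ → ℝ} {σ m : ℕ} {g : ℕ → ℕ × ℕ}
    (h : Listed s A B σ m g) :
    (window A B σ m (s.real 4 0) (s.real 5 0)).card ≤ s.nat 7 0 - s.nat 6 0 := by
  have : window A B σ m (s.real 4 0) (s.real 5 0) ⊆
      (Finset.Ico (s.nat 6 0) (s.nat 7 0)).image g := by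
    rintro ⟨x, y⟩ hz
    obtain ⟨z, h1, h2, h3⟩ := h.mem x y hz
    exact Finset.mem_image.2 ⟨z, Finset.mem_Ico.2 ⟨h1, h2⟩, h3⟩
  simpa using (Finset.card_le_card this).trans Finset.card_image_le

theorem GreedySpec.exists_pierces {α β : ℕ → ℝ} {n cnt : ℕ} {d : ℝ} {out : ℕ → ℝ}
    (h : GreedySpec α β n d cnt out) :
    ∃ S : Finset ℝ, S.card ≤ cnt ∧ Pierces α β n d S := by
  have hcard : ((Finset.range cnt).image out).card ≤ cnt := by
    simpa using Finset.card_image_le (s := Finset.range cnt) (f := out)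
  refine ⟨_, hcard, fun i hi => ?_⟩
  obtain ⟨j, hj, hj'⟩ := h.pierced i hi
  exact ⟨_, Finset.mem_image_of_mem _ (Finset.mem_range.2 hj), hj'⟩

/-- With at most `k` greedy centers the tested gap becomes `hi`; with more, their chain makes it a
valid `lo`. The window is open, so in both cases the tested entry itself is discarded and at most
half of the list remains. -/
theorem wp_bisect {s : State} {α β A B : ℕ → ℝ} {πA πB : ℕ → ℕ} {n k σ m : ℕ} {g : ℕ → ℕ × ℕ}
    (hI : SearchInv s α β πA πB n k) (hL : Listed s A B σ m g) (hπ : SortsBy β n πB)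
    (hab : ∀ i < n, α i ≤ β i) :
    wp bisect s fun t s' => t ≤ 60 * n + 80 ∧ s'.nat 5 0 = s.nat 5 0 ∧
      SearchInv s' α β πA πB n k ∧ Listed s' A B σ m g ∧
      s'.nat 7 0 - s'.nat 6 0 ≤ (s.nat 7 0 - s.nat 6 0) / 2 := by
  refine wp_branch (fun hb => ?_) (fun hb => ?_)
  · simp at hb
    refine wp_seq (wp_setNat (wp_seq (wp_setReal (wp_seq ?_))))
    set L := s.nat 6 0 with hLdef
    set H := s.nat 7 0 with hHdef
    set M := (L + H) / 2 with hM
    have hMH : M < H := by omega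
    have hLM : L ≤ M := by omega
    set d := s.real 3 (s.nat 4 M) with hd
    have hdb := hL.bounds M hLM hMH
    have h0 : 0 ≤ d := hI.nonneg.trans hdb.1
    refine wp_mono (wp_greedy (n := n) (d := d) ?_ ?_ ?_ h0 ?_) ?_
    · simpa using hI.n_eq
    · simp [hd, hM, hLdef, hHdef]
    · simpa [hI.β_eq, hI.πB_eq] using hπ
    · simpa [hI.β_eq, hI.α_eq] using hab
    · rintro t s₁ ⟨h1, h2, h3, h4⟩
      simp [hI.α_eq, hI.β_eq] at h4
      have e1 : s₁.nat 9 0 = M := by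
        rw [h2 9 (by norm_num) (by norm_num)]; simp [hM, hLdef, hHdef]
      have e2 : s₁.nat 1 0 = k := by
        rw [h2 1 (by norm_num) (by norm_num)]; simpa using hI.k_eq
      have e3 : s₁.real 6 0 = d := by
        rw [h3 6 (by norm_num)]; simp [hd, hM, hLdef, hHdef]
      have en : ∀ y < 9, s₁.nat y = s.nat y := fun y hy => by
        rw [h2 y (by omega) (by omega)]
        simp [show y ≠ 9 by omega]
      have er : ∀ y, y ≠ 2 → y ≠ 6 → s₁.real y = s.real y := fun y hy hy' => by
        rw [h3 y hy]
        simp [hy']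
      have f5 : s₁.nat 5 0 = s.nat 5 0 := by rw [en 5 (by norm_num)]
      have f6 : s₁.nat 6 0 = L := by rw [en 6 (by norm_num)]
      have f7 : s₁.nat 7 0 = H := by rw [en 7 (by norm_num)]
      have f4 : s₁.nat 4 = s.nat 4 := en 4 (by norm_num)
      have r3 : s₁.real 3 = s.real 3 := er 3 (by norm_num) (by norm_num)
      have r4 : s₁.real 4 = s.real 4 := er 4 (by norm_num) (by norm_num)
      have r5 : s₁.real 5 = s.real 5 := er 5 (by norm_num) (by norm_num)
      have f0 : s₁.nat 0 0 = n := by rw [en 0 (by norm_num), hI.n_eq]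
      have f2 : s₁.nat 2 = πA := by rw [en 2 (by norm_num), hI.πA_eq]
      have f3 : s₁.nat 3 = πB := by rw [en 3 (by norm_num), hI.πB_eq]
      have r0 : s₁.real 0 = α := by rw [er 0 (by norm_num) (by norm_num), hI.α_eq]
      have r1 : s₁.real 1 = β := by rw [er 1 (by norm_num) (by norm_num), hI.β_eq]
      refine wp_branch (fun hb' => ?_) (fun hb' => ?_)
      · simp [e2] at hb'
        refine wp_seq (wp_setReal (wp_setNat ?_))
        refine ⟨by simp; omega, by simpa using f5, ⟨?_, ?_, ?_, ?_, ?_, ?_, ?_, ?_, ?_⟩,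
          ⟨?_, ?_, ?_, ?_⟩, ?_⟩
        · simpa using f0
        · simpa using e2
        · simpa using f2
        · simpa using f3
        · simpa using r0
        · simpa using r1
        · simpa [r4] using hI.nonneg
        · simpa [r4] using hI.chain
        · obtain ⟨S, hS, hS'⟩ := h4.exists_pierces
          simp only [RealExpr.eval, NatExpr.eval, State.real_setReal_self, State.real_setNat,
            Function.update_self, e3]
          exact ⟨h0, S, by omega, hS'⟩
        · simp [e1, e3, f4, f6, r3, r4]
          exact fun z hz hz' => ⟨(hL.bounds z hz (by omega)).1, hL.sorted z M (by omega) hMH⟩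
        · simp [e1, f4, r3]
          exact fun z z' hz hz' => hL.sorted z z' hz (by omega)
        · simp [e1, f4, r3]
          exact fun z hz => hL.eq z (by omega)
        · simp only [mem_window]
          simp [e1, e3, f6, r4]
          intro x y hx hy hlo hhi
          obtain ⟨z, hz, hz', hz''⟩ := hL.mem x y
            (mem_window.2 ⟨⟨hx, hy⟩, hlo, hhi.trans_le hdb.2⟩)
          refine ⟨z, hz, ?_, hz''⟩
          -- From position `M` on, entries are at least the new `hi` and so are outside the open
          -- window; equal entries do no harm.
          by_contra hzM
          have h5 := hL.sorted M z (by omega) hz'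
          rw [hL.eq z hz', hz''] at h5
          simp only at h5
          linarith
        · simp [e1, f6]
          omega
      · simp [e2] at hb'
        refine wp_seq (wp_setReal (wp_setNat ?_))
        refine ⟨by simp; omega, by simpa using f5, ⟨?_, ?_, ?_, ?_, ?_, ?_, ?_, ?_, ?_⟩,
          ⟨?_, ?_, ?_, ?_⟩, ?_⟩
        · simpa using f0
        · simpa using e2
        · simpa using f2
        · simpa using f3
        · simpa using r0
        · simpa using r1
        · simpa [e3] using h0
        · simp only [RealExpr.eval, NatExpr.eval, State.real_setReal_self, State.real_setNat,
            Function.update_self, e3]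
          exact h4.chain.mono (by omega) fun _ _ _ _ h => h
        · simpa [r5] using hI.cover
        · simp [e1, e3, f4, f7, r3, r5]
          exact fun z hz hz' => ⟨hL.sorted M z (by omega) hz', (hL.bounds z (by omega) hz').2⟩
        · simpa [f7, f4, r3] using hL.sorted
        · simpa [f7, f4, r3] using hL.eq
        · simp only [mem_window]
          simp [e1, e3, f7, r5]
          intro x y hx hy hlo hhi
          obtain ⟨z, hz, hz', hz''⟩ := hL.mem x y
            (mem_window.2 ⟨⟨hx, hy⟩, hdb.1.trans_lt hlo, hhi⟩)
          refine ⟨z, ?_, hz', hz''⟩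
          by_contra hzM
          have h5 := hL.sorted z M (by omega) hMH
          rw [hL.eq z hz', hz''] at h5
          simp only at h5
          linarith
        · simp [e1, f7]
          omega
  · simp at hb
    refine wp_skip ⟨by simp, rfl, hI, hL, by omega⟩

theorem SearchInv.frame {s s' : State} {α β : ℕ → ℝ} {πA πB : ℕ → ℕ} {n k : ℕ}
    (h : SearchInv s α β πA πB n k) (hf : ∀ y < 4, s'.nat y = s.nat y)
    (hr : ∀ y, y ≠ 3 → s'.real y = s.real y) : SearchInv s' α β πA πB n k := by
  constructor
  · rw [hf 0 (by norm_num), h.n_eq]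
  · rw [hf 1 (by norm_num), h.k_eq]
  · rw [hf 2 (by norm_num), h.πA_eq]
  · rw [hf 3 (by norm_num), h.πB_eq]
  · rw [hr 0 (by norm_num), h.α_eq]
  · rw [hr 1 (by norm_num), h.β_eq]
  · rw [hr 4 (by norm_num)]; exact h.nonneg
  · rw [hr 4 (by norm_num)]; exact h.chain
  · rw [hr 5 (by norm_num)]; exact h.cover

/-- List the gaps between the bounds, for the indices that are multiples of the stride, and sort
them. -/
def listGaps : Program :=
  .seq collect <|
  .seq (.setNat 20 (.lit 0) (nv 8)) <|
  .seq (sortIndices 3 4) <|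
  .seq (.setNat 6 (.lit 0) (.lit 0)) <|
  .setNat 7 (.lit 0) (nv 8)

/-- The number of gaps actually listed is at most the window size, hence at most `w`, and the
sorting bound is monotone. -/
theorem wp_listGaps {s : State} {α β : ℕ → ℝ} {πA πB : ℕ → ℕ} {n k σ m w : ℕ}
    (hI : SearchInv s α β πA πB n k) (hσ : s.nat 5 0 = σ) (hm : ∀ x, σ * x < n ↔ x < m)
    (hπA : SortsBy α n πA) (hπB : SortsBy β n πB)
    (hw : (window (fun y => α (πA y)) (fun x => β (πB x)) σ m (s.real 4 0) (s.real 5 0)).card ≤ w) :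
    wp listGaps s fun t s' => t ≤ 240 * m + 60 * w + 100 + 500 * (w + 1) * (Nat.clog 2 w + 1) ∧
      s'.nat 5 0 = σ ∧ SearchInv s' α β πA πB n k ∧
      s'.nat 7 0 - s'.nat 6 0 ≤ w ∧
      ∃ g, Listed s' (fun y => α (πA y)) (fun x => β (πB x)) σ m g := by
  have hctx : CollectCtx s n σ (fun y => α (πA y)) (fun x => β (πB x)) (s.real 4 0)
      (s.real 5 0) :=
    ⟨hI.n_eq, hσ, fun y => by rw [hI.α_eq, hI.πA_eq], fun x => by rw [hI.β_eq, hI.πB_eq],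
      rfl, rfl⟩
  refine wp_seq (wp_mono (wp_collect hctx hm hπA.sorted hπB.sorted) ?_)
  rintro t s₁ ⟨h1, h2, h3, f, h4⟩
  refine wp_seq (wp_setNat (wp_seq ?_))
  have hN : s₁.nat 8 0 ≤ w := (h4.le_card (m := m) fun z hz => ⟨hz.1, hz.2.1⟩).trans hw
  set N := s₁.nat 8 0 with hNdef
  refine wp_mono (wp_sortIndices (x := 3) (p := 4) (by norm_num) (N := N) (by simp [hNdef])) ?_
  rintro t' s₂ ⟨i1, i2, i3, i4⟩
  rw [State.real_setNat] at i2 i4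
  have e8 : s₂.nat 8 0 = N := by
    rw [i3 8 (by norm_num) (by norm_num)]; simp [hNdef]
  have en : ∀ y < 8, y ≠ 4 → s₂.nat y = s.nat y := fun y hy hy' => by
    rw [i3 y (by omega) hy', ← h3 y hy]
    simp [show y ≠ 20 by omega]
  have er : ∀ y, y ≠ 3 → s₂.real y = s.real y := fun y hy => by rw [i2, h2 y hy]
  refine wp_seq (wp_setNat (wp_setNat ⟨?_, ?_, hI.frame ?_ ?_, ?_, fun z => f (s₂.nat 4 z), ?_⟩))
  · have h5 : 500 * (N + 1) * (Nat.clog 2 N + 1) ≤ 500 * (w + 1) * (Nat.clog 2 w + 1) :=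
      Nat.mul_le_mul (by omega) (Nat.add_le_add_right (Nat.clog_mono_right 2 hN) 1)
    simp
    omega
  · simpa [en 5 (by norm_num) (by norm_num)] using hσ
  · intro y hy
    rw [State.nat_setNat_ne _ _ _ (by omega), State.nat_setNat_ne _ _ _ (by omega),
      en y (by omega) (by omega)]
  · simpa using er
  · simp [e8]
    exact hN
  · constructor
    · simp [e8]
      intro z hz
      have := h4.bounds _ (i4.valid z hz)
      rw [i2, h2 4 (by norm_num), h2 5 (by norm_num)]
      exact ⟨this.1.le, this.2.le⟩
    · simp [e8]
      intro z z' hz hz'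
      rw [i2]
      exact i4.sorted z z' hz hz'
    · simp [e8]
      intro z hz
      rw [i2]
      exact h4.eq _ (i4.valid z hz)
    · intro x y hz
      simp [e8, mem_window, er 4, er 5] at hz ⊢
      obtain ⟨r, hr, hr'⟩ := h4.surj x y ⟨hz.1.1, hz.1.2, Or.inl hz.1.1⟩ hz.2.1 hz.2.2
      obtain ⟨z, hz, rfl⟩ := i4.surj r hr
      exact ⟨z, hz, hr'⟩

/-! ### The search over decreasing strides and its cost. -/

/-- The number of multiples of `2 ^ e` below `n`. -/
def numRows (n e : ℕ) : ℕ := (n + 2 ^ e - 1) / 2 ^ e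

theorem lt_numRows {n e x : ℕ} : 2 ^ e * x < n ↔ x < numRows n e := by
  have h := Nat.two_pow_pos e
  have h' : x < numRows n e ↔ (x + 1) * 2 ^ e ≤ n + 2 ^ e - 1 := Nat.le_div_iff_mul_le h
  rw [h', Nat.succ_mul, mul_comm x]
  omega

theorem numRows_le_div (n e : ℕ) : numRows n e ≤ n / 2 ^ e + 1 := by
  have h := Nat.two_pow_pos e
  have : (n + 2 ^ e) / 2 ^ e = n / 2 ^ e + 1 := Nat.add_div_right _ h
  rw [← this]
  exact Nat.div_le_div_right (by omega)

theorem numRows_zero (n : ℕ) : numRows n 0 = n := by simp [numRows]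

theorem numRows_succ_le (n e : ℕ) : numRows n (e + 1) ≤ numRows n e := by
  by_contra! h
  have h1 := lt_numRows.2 h
  have h2 : ¬ 2 ^ e * numRows n e < n := fun h => lt_irrefl _ (lt_numRows.1 h)
  rw [pow_succ] at h1
  have := Nat.mul_le_mul_right (numRows n e) (show 2 ^ e ≤ 2 ^ e * 2 by omega)
  omega

theorem numRows_le (n e : ℕ) : numRows n e ≤ n := by
  induction e with
  | zero => rw [numRows_zero]
  | succ e ih => exact (numRows_succ_le n e).trans ih

theorem clog_sixteen_mul_le {m n : ℕ} (h : m ≤ n) :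
    Nat.clog 2 (16 * m) ≤ Nat.clog 2 n + 4 := by
  refine Nat.clog_le_of_le_pow ?_
  have := Nat.le_pow_clog (b := 2) (by norm_num) n
  rw [pow_add]
  omega

/-- Find the optimal radius, starting from the bounds `lo` and `hi`. -/
def search : Program :=
  .seq (.setNat 5 (.lit 0) (.lit 1)) <|
  .seq (.loop (natLt (nv 5) (nv 0)) (.setNat 5 (.lit 0) (.add (nv 5) (nv 5)))) <|
  .seq (.loop (.natLe (.lit 2) (nv 5))
    (.seq listGaps <| .seq bisect <| .seq bisect <| .seq bisect <|
      .setNat 5 (.lit 0) (.half (nv 5)))) <|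
  .seq listGaps <|
  .loop (natLt (nv 6) (nv 7)) bisect

/-- A bound for the number of operations of the search with stride `2 ^ e`. -/
def levelCost (n e : ℕ) : ℕ := 10000 * (Nat.clog 2 n + 5) * (numRows n e + 1) + 180 * n

/-- The row counts sum to `O(n)` as a geometric series, which is multiplied by one logarithm for
sorting; the linear greedy tests contribute `n` for each of the `Nat.clog 2 n` levels. -/
theorem sum_levelCost_le (n : ℕ) :
    ∑ e ∈ Finset.range (Nat.clog 2 n), levelCost n (e + 1) ≤
      300000 * n * (Nat.clog 2 n + 1) := by
  set c := Nat.clog 2 n with hc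
  have hcn : c ≤ n := Nat.clog_le_of_le_pow Nat.lt_two_pow_self.le
  have h1 : ∀ e ∈ Finset.range c, levelCost n (e + 1) ≤
      10000 * (c + 5) * (n / 2 ^ e + 2) + 180 * n := by
    intro e _
    -- The weaker bound with exponent `e` matches the geometric sum, which starts at exponent 0.
    have h2 : numRows n (e + 1) + 1 ≤ n / 2 ^ e + 2 :=
      Nat.add_le_add_right ((numRows_succ_le n e).trans (numRows_le_div n e)) 1
    exact Nat.add_le_add_right (Nat.mul_le_mul_left _ h2) _
  refine (Finset.sum_le_sum h1).trans ?_
  rw [Finset.sum_add_distrib, ← Finset.mul_sum, Finset.sum_add_distrib]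
  have h3 : ∑ e ∈ Finset.range c, n / 2 ^ e ≤ 2 * n := by
    have := Nat.geom_sum_le (b := 2) le_rfl n c
    omega
  simp only [Finset.sum_const, Finset.card_range, smul_eq_mul]
  have h4 : 10000 * (c + 5) * (∑ e ∈ Finset.range c, n / 2 ^ e + c * 2) ≤
      10000 * (c + 5) * (4 * n) := Nat.mul_le_mul_left _ (by omega)
  have h5 : 10000 * (c + 5) * (4 * n) = 40000 * (c * n) + 200000 * n := by ring
  have h6 : c * (180 * n) = 180 * (c * n) := by ring
  have h7 : 300000 * n * (c + 1) = 300000 * (c * n) + 300000 * n := by ring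
  omega

/-- The binary length of the number of candidates serves as potential of the final bisection loop.
-/
theorem size_lt_of_le_half {d d' : ℕ} (h : d' ≤ d / 2) (hd : 0 < d) :
    Nat.size d' + 1 ≤ Nat.size d := by
  have h1 : d < 2 ^ Nat.size d := Nat.lt_size_self d
  have h2 : 0 < Nat.size d := Nat.size_pos.2 hd
  obtain ⟨t, ht⟩ : ∃ t, Nat.size d = t + 1 := ⟨Nat.size d - 1, by omega⟩
  rw [ht, pow_succ] at h1
  rw [ht]
  exact Nat.add_le_add_right (Nat.size_le.2 (by omega)) 1

theorem wp_search {s : State} {α β : ℕ → ℝ} {πA πB : ℕ → ℕ} {n k : ℕ} (hn : 1 ≤ n)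
    (hI : SearchInv s α β πA πB n k) (hπA : SortsBy α n πA) (hπB : SortsBy β n πB)
    (hab : ∀ i < n, α i ≤ β i) :
    wp search s fun t s' => t ≤ 1000000 * n * (Nat.clog 2 n + 1) ∧
      SearchInv s' α β πA πB n k ∧ GapChain α β n (k + 1) (s'.real 5 0 ≤ ·) := by
  set A : ℕ → ℝ := fun y => α (πA y) with hA
  set B : ℕ → ℝ := fun x => β (πB x) with hB
  set c := Nat.clog 2 n with hc
  refine wp_seq (wp_setNat (wp_seq ?_))
  refine wp_loop (fun φ s' => ∃ e, e ≤ c ∧ φ = 20 * (c - e) ∧ s'.nat 5 0 = 2 ^ e ∧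
    SearchInv s' α β πA πB n k) ?_ (φ := 20 * c) ?_ ?_
  · rintro φ s' ⟨e, he, rfl, h5, hs'⟩ ht
    simp [hs'.n_eq, h5] at ht
    have hlt : e < c := (Nat.lt_clog_iff_pow_lt (by norm_num)).2 ht
    refine wp_setNat ⟨_, ⟨e + 1, hlt, rfl, ?_, hs'.frame ?_ fun _ _ => rfl⟩, ?_⟩
    · simp [h5]; ring
    · intro y hy
      rw [State.nat_setNat_ne _ _ _ (by omega)]
    · simp
      omega
  · refine ⟨0, by simp, by simp, by simp, hI.frame ?_ fun _ _ => rfl⟩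
    intro y hy
    rw [State.nat_setNat_ne _ _ _ (by omega)]
  rintro t₁ φ₁ s₁ ⟨e₁, he₁, rfl, h5₁, hs₁⟩ ht₁ hle₁
  simp [hs₁.n_eq, h5₁] at ht₁ hle₁
  obtain rfl : e₁ = c := le_antisymm he₁ (Nat.clog_le_of_le_pow ht₁)
  -- The stride is now at least `n`, so 0 is the only possible index and the window has at most one
  -- pair.
  have hrows : numRows n c ≤ 1 := by
    by_contra! h
    have := lt_numRows.2 h
    omega
  refine wp_seq (wp_loop (fun φ s' => ∃ e, φ = ∑ j ∈ Finset.range e, levelCost n (j + 1) ∧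
    s'.nat 5 0 = 2 ^ e ∧ SearchInv s' α β πA πB n k ∧
    (window A B (2 ^ e) (numRows n e) (s'.real 4 0) (s'.real 5 0)).card ≤ 16 * numRows n e)
    ?_ (φ := ∑ j ∈ Finset.range c, levelCost n (j + 1)) ?_ ?_)
  · rintro φ s₂ ⟨e, rfl, h5, hs₂, hcard⟩ ht
    simp [h5] at ht
    obtain ⟨e, rfl⟩ : ∃ e', e = e' + 1 := by
      cases e with
      | zero => simp at ht
      | succ e => exact ⟨e, rfl⟩
    set m := numRows n (e + 1) with hm
    have hmn : m ≤ n := numRows_le _ _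
    refine wp_seq (wp_mono (wp_listGaps hs₂ h5 (fun x => lt_numRows) hπA hπB hcard) ?_)
    rintro t₃ s₃ ⟨a1, a2, a3, a4, g, a5⟩
    refine wp_seq (wp_mono (wp_bisect a3 a5 hπB hab) ?_)
    rintro t₄ s₄ ⟨b1, b2, b3, b4, b5⟩
    refine wp_seq (wp_mono (wp_bisect b3 b4 hπB hab) ?_)
    rintro t₅ s₅ ⟨c1, c2, c3, c4, c5⟩
    refine wp_seq (wp_mono (wp_bisect c3 c4 hπB hab) ?_)
    rintro t₆ s₆ ⟨d1, d2, d3, d4, d5⟩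
    have hcard' : (window A B (2 ^ (e + 1)) m (s₆.real 4 0) (s₆.real 5 0)).card ≤
      s₆.nat 7 0 - s₆.nat 6 0 := d4.card_le
    have e5 : s₆.nat 5 0 = 2 ^ (e + 1) := by rw [d2, c2, b2, a2]
    refine wp_setNat ⟨_, ⟨e, rfl, ?_, d3.frame ?_ fun _ _ => rfl, ?_⟩, ?_⟩
    · simp [e5, pow_succ]
    · intro y hy
      rw [State.nat_setNat_ne _ _ _ (by omega)]
    · simp only [State.real_setNat]
      have hpow : 2 ^ (e + 1) = 2 * 2 ^ e := pow_succ' 2 e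
      -- Three bisections reduced `16 * m` candidates to `2 * m`; refinement gives `4 * (2 * m) + 8
      -- * m = 16 * m`, and `m` is at most the new number of rows. This fixes the constant 16.
      have h6 := card_window_le (A := A) (B := B) (σ := 2 ^ e) (n := n) (m := m)
        (m' := numRows n e) (lo := s₆.real 4 0) (hi := s₆.real 5 0)
        (fun x => by rw [← hpow]; exact lt_numRows) (fun x => lt_numRows) hπA.sorted hπB.sorted
      have h7 : m ≤ numRows n e := numRows_succ_le n e
      rw [hpow] at hcard'
      omega
    · rw [Finset.sum_range_succ, levelCost, ← hm, ← hc]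
      have h8 : 500 * (16 * m + 1) * (Nat.clog 2 (16 * m) + 1) ≤
          500 * (16 * m + 1) * (c + 5) := Nat.mul_le_mul_left _ (by
            have := clog_sixteen_mul_le hmn
            omega)
      have h9 : 500 * (16 * m + 1) * (c + 5) = 8000 * (m * c) + 40000 * m + 500 * c + 2500 := by
        ring
      have h10 : 10000 * (c + 5) * (m + 1) = 10000 * (m * c) + 50000 * m + 10000 * c + 50000 := by
        ring
      simp
      omega
  · refine ⟨c, rfl, h5₁, hs₁, ?_⟩
    have h6 : (window A B (2 ^ c) (numRows n c) (s₁.real 4 0) (s₁.real 5 0)).card ≤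
        numRows n c * numRows n c := by
      simpa [window] using Finset.card_filter_le (Finset.range (numRows n c) ×ˢ
        Finset.range (numRows n c)) fun z => s₁.real 4 0 < gap A B (2 ^ c) z.1 z.2 ∧
          gap A B (2 ^ c) z.1 z.2 < s₁.real 5 0
    have h7 := Nat.mul_le_mul_right (numRows n c) hrows
    omega
  rintro t₂ φ₂ s₂ ⟨e, rfl, h5, hs₂, hcard⟩ ht₂ hle₂
  simp [h5] at ht₂ hle₂
  obtain rfl : e = 0 := by
    by_contra h
    have := Nat.pow_le_pow_right (n := 2) (by norm_num) (Nat.one_le_iff_ne_zero.2 h)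
    omega
  rw [numRows_zero, pow_zero] at hcard
  refine wp_seq (wp_mono (wp_listGaps hs₂ h5 (m := n) (fun x => by simp) hπA hπB hcard) ?_)
  rintro t₃ s₃ ⟨a1, a2, a3, a4, g, a5⟩
  refine wp_loop (fun φ s' => φ = (60 * n + 100) * Nat.size (s'.nat 7 0 - s'.nat 6 0) ∧
    SearchInv s' α β πA πB n k ∧ Listed s' A B 1 n g) ?_ ⟨rfl, a3, a5⟩ ?_
  · rintro φ s' ⟨rfl, b1, b2⟩ ht
    simp at ht
    refine wp_mono (wp_bisect b1 b2 hπB hab) ?_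
    rintro t s'' ⟨c1, c2, c3, c4, c5⟩
    refine ⟨_, ⟨rfl, c3, c4⟩, ?_⟩
    have h6 := Nat.mul_le_mul_left (60 * n + 100) (size_lt_of_le_half c5 (by omega))
    rw [mul_add] at h6
    simp
    omega
  · rintro t₄ φ' s' ⟨rfl, b1, b2⟩ ht hle
    simp at ht hle
    refine ⟨?_, b1, b1.chain.mono le_rfl ?_⟩
    · have h6 := sum_levelCost_le n
      rw [← hc] at h6
      -- At most `16 * n < 2 ^ (c + 5)` candidates remain at stride 1.
      have h7 : Nat.size (s₃.nat 7 0 - s₃.nat 6 0) ≤ c + 5 := by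
        refine Nat.size_le.2 (lt_of_le_of_lt a4 ?_)
        have : n ≤ 2 ^ c := Nat.le_pow_clog (by norm_num) n
        rw [pow_add]
        omega
      have h8 := Nat.mul_le_mul_left (60 * n + 100) h7
      have h9 : 500 * (16 * n + 1) * (Nat.clog 2 (16 * n) + 1) ≤
          500 * (16 * n + 1) * (c + 5) := Nat.mul_le_mul_left _ (by
            have := clog_sixteen_mul_le (le_refl n)
            omega)
      have h10 : 500 * (16 * n + 1) * (c + 5) = 8000 * (n * c) + 40000 * n + 500 * c + 2500 := by
        ring
      have h11 : (60 * n + 100) * (c + 5) = 60 * (n * c) + 300 * n + 100 * c + 500 := by ring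
      have h12 : 300000 * n * (c + 1) = 300000 * (n * c) + 300000 * n := by ring
      have h13 : 1000000 * n * (c + 1) = 1000000 * (n * c) + 1000000 * n := by ring
      have h14 : c ≤ n * c := Nat.le_mul_of_pos_left c hn
      simp
      omega
    · intro i hi j hj hlo
      obtain ⟨y, hy, rfl⟩ := hπA.surj i hi
      obtain ⟨x, hx, rfl⟩ := hπB.surj j hj
      -- The list is empty, so no gap lies strictly between the bounds: gaps above `lo` are at least
      -- `hi`.
      by_contra! hhi
      obtain ⟨z, hz, hz', -⟩ := b2.mem x y (mem_window.2 ⟨⟨hx, hy⟩, by simpa [gap, hA, hB] using hlo,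
        by simpa [gap, hA, hB] using hhi⟩)
      omega

/-! ### The complete program and its correctness. -/

/-- Append further centers until there are `k`. -/
def pad : Program :=
  .loop (natLt (nv 11) (nv 1)) <|
  .seq (.setReal 2 (nv 11) (.add (.get 2 (.sub (nv 11) (.lit 1))) .one)) <|
  .setNat 11 (.lit 0) (.add (nv 11) (.lit 1))

/-- Stepping by 1 beyond the last center keeps the centers strictly increasing, hence distinct. With
no center yet, the truncated index reads cell 0, whose arbitrary value is harmless. -/
theorem wp_pad {s : State} {k cnt : ℕ} (hk : s.nat 1 0 = k) (hcnt : s.nat 11 0 = cnt)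
    (hle : cnt ≤ k) (hinc : ∀ j, j + 1 < cnt → s.real 2 j < s.real 2 (j + 1)) :
    wp pad s fun t s' => t ≤ 40 * k + 40 ∧
      (∀ j, j + 1 < k → s'.real 2 j < s'.real 2 (j + 1)) ∧
      ∀ j < cnt, s'.real 2 j = s.real 2 j := by
  refine wp_loop (fun φ s' => φ = 40 * (k - s'.nat 11 0) ∧ s'.nat 1 0 = k ∧ cnt ≤ s'.nat 11 0 ∧
    s'.nat 11 0 ≤ k ∧ (∀ j, j + 1 < s'.nat 11 0 → s'.real 2 j < s'.real 2 (j + 1)) ∧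
    ∀ j < cnt, s'.real 2 j = s.real 2 j) ?_ (φ := 40 * (k - cnt)) ?_ ?_
  · rintro φ s' ⟨rfl, h1, h2, h3, h4, h5⟩ ht
    simp [h1] at ht
    refine wp_seq (wp_setReal (wp_setNat ⟨_, ⟨rfl, ?_, ?_, ?_, ?_, ?_⟩, ?_⟩))
    · simpa using h1
    · simp; omega
    · simp; omega
    · intro j hj
      simp at hj ⊢
      rw [Function.update_of_ne (by omega)]
      by_cases hj' : j + 1 = s'.nat 11 0
      · rw [← hj']; simp
      · rw [Function.update_of_ne hj']
        exact h4 j (by omega)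
    · intro j hj
      simp
      rw [Function.update_of_ne (by omega)]
      exact h5 j hj
    · simp
      omega
  · exact ⟨by rw [hcnt], hk, hcnt.ge, hcnt.trans_le hle, by rwa [hcnt], fun _ _ => rfl⟩
  · rintro t φ' s' ⟨rfl, h1, h2, h3, h4, h5⟩ ht hle'
    simp [h1] at ht hle'
    have : s'.nat 11 0 = k := by omega
    rw [this] at h4
    exact ⟨by omega, h4, h5⟩

/-- Sort the intervals by their left and by their right endpoints, find the optimal radius, and
choose the centers for it greedily. -/
def solve : Program :=
  .seq (.setNat 20 (.lit 0) (nv 0)) <|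
  .seq (sortIndices 0 2) <|
  .seq (sortIndices 1 3) <|
  .seq (.setReal 6 (.lit 0) .zero) <|
  .seq greedy <|
  .branch (.natLe (nv 11) (nv 1)) .skip <|
  .seq (.setReal 4 (.lit 0) .zero) <|
  .seq (.setReal 5 (.lit 0)
    (.sub (.get 0 (.get 2 (.sub (nv 0) (.lit 1)))) (.get 1 (.get 3 (.lit 0))))) <|
  .seq search <|
  .seq (.setReal 6 (.lit 0) (rv 5)) <|
  greedy

theorem wp_solve {s : State} {n k : ℕ} (hn : s.nat 0 0 = n) (hk : s.nat 1 0 = k) (hk1 : 1 ≤ k)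
    (hab : ∀ i < n, s.real 0 i ≤ s.real 1 i) :
    wp solve s fun t s' => t ≤ 2000000 * (n + 1) * (Nat.clog 2 n + 1) ∧ s'.nat 1 0 = k ∧
      s'.nat 11 0 ≤ k ∧ ∃ d, 0 ≤ d ∧
        GreedySpec (s.real 0) (s.real 1) n d (s'.nat 11 0) (s'.real 2) ∧
        (d = 0 ∨ GapChain (s.real 0) (s.real 1) n (k + 1) (d ≤ ·)) := by
  set α := s.real 0 with hα
  set β := s.real 1 with hβ
  set c := Nat.clog 2 n with hc
  refine wp_seq (wp_setNat (wp_seq (wp_mono (wp_sortIndices (N := n) (by norm_num) ?_) ?_)))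
  · simpa using hn
  rintro t₁ s₁ ⟨a1, a2, a3, a4⟩
  refine wp_seq (wp_mono (wp_sortIndices (N := n) (by norm_num) ?_) ?_)
  · rw [a3 20 (by norm_num) (by norm_num)]; simpa using hn
  rintro t₂ s₂ ⟨b1, b2, b3, b4⟩
  rw [State.real_setNat] at a2 a4
  rw [← hc] at a1 b1
  set πA := s₁.nat 2 with hπA
  set πB := s₂.nat 3 with hπB
  rw [a2] at b4
  have r₂ : s₂.real = s.real := b2.trans a2
  have e0 : s₂.nat 0 0 = n := by
    rw [b3 0 (by norm_num) (by norm_num), a3 0 (by norm_num) (by norm_num)]; simpa using hn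
  have e1 : s₂.nat 1 0 = k := by
    rw [b3 1 (by norm_num) (by norm_num), a3 1 (by norm_num) (by norm_num)]; simpa using hk
  have e2 : s₂.nat 2 = πA := b3 2 (by norm_num) (by norm_num)
  refine wp_seq (wp_setReal (wp_seq (wp_mono (wp_greedy (n := n) (d := 0) ?_ ?_ ?_ le_rfl ?_) ?_)))
  · simpa using e0
  · simp
  · simpa [r₂] using b4
  · simpa [r₂] using hab
  rintro t₃ s₃ ⟨c1, c2, c3, c4⟩
  simp [r₂] at c4
  rw [← hα, ← hβ] at c4
  have f0 : s₃.nat 0 0 = n := by rw [c2 0 (by norm_num) (by norm_num)]; simpa using e0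
  have f1 : s₃.nat 1 0 = k := by rw [c2 1 (by norm_num) (by norm_num)]; simpa using e1
  have f2 : s₃.nat 2 = πA := by rw [c2 2 (by norm_num) (by norm_num)]; simpa using e2
  have f3 : s₃.nat 3 = πB := by rw [c2 3 (by norm_num) (by norm_num)]; simp [hπB]
  have g0 : s₃.real 0 = α := by rw [c3 0 (by norm_num)]; simp [r₂, hα]
  have g1 : s₃.real 1 = β := by rw [c3 1 (by norm_num)]; simp [r₂, hβ]
  have hbound : 2000000 * (n + 1) * (c + 1) =
      2000000 * (n * c) + 2000000 * n + 2000000 * c + 2000000 := by ring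
  have hbound' : 500 * (n + 1) * (c + 1) = 500 * (n * c) + 500 * n + 500 * c + 500 := by ring
  refine wp_branch (fun hb => wp_skip ?_) (fun hb => ?_)
  · simp [f1] at hb
    refine ⟨?_, f1, hb, 0, le_rfl, c4, Or.inl rfl⟩
    simp
    omega
  simp [f1] at hb
  have hn1 : 1 ≤ n := by
    obtain ⟨ch, hch, -⟩ := c4.chain
    have := hch 0 (by omega)
    omega
  set h₀ := α (πA (n - 1)) - β (πB 0) with hh₀
  have hA : ∀ i < n, α i ≤ α (πA (n - 1)) := by
    intro i hi
    obtain ⟨y, hy, rfl⟩ := a4.surj i hi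
    exact a4.sorted y (n - 1) (by omega) (by omega)
  have hB : ∀ i < n, β (πB 0) ≤ β i := by
    intro i hi
    obtain ⟨x, hx, rfl⟩ := b4.surj i hi
    exact b4.sorted 0 x (by omega) hx
  -- More than `k ≥ 1` greedy centers give a chain of at least two intervals; its first gap is
  -- positive, and `h₀` is the largest gap.
  have hpos : 0 ≤ h₀ := by
    obtain ⟨ch, hch, hgap⟩ := c4.chain
    have h1 := hgap 0 (by omega)
    have h2 := hA _ (hch 1 (by omega))
    have h3 := hB _ (hch 0 (by omega))
    rw [zero_add] at h1
    linarith
  refine wp_seq (wp_setReal (wp_seq (wp_setReal (wp_seq (wp_mono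
    (wp_search (α := α) (β := β) (πA := πA) (πB := πB) (n := n) (k := k) hn1
      ⟨?_, ?_, ?_, ?_, ?_, ?_, ?_, ?_, ?_⟩ a4 b4 hab) ?_)))))
  · simpa using f0
  · simpa using f1
  · simpa using f2
  · simpa using f3
  · simpa using g0
  · simpa using g1
  · simp
  · simpa using c4.chain.mono (len' := k + 1) (by omega) fun _ _ _ _ h => h
  · simp only [RealExpr.eval, NatExpr.eval, State.real_setReal_self, Function.update_self,
      State.nat_setReal, State.real_setReal_ne _ _ _ (show (0 : ℕ) ≠ 4 by norm_num),
      State.real_setReal_ne _ _ _ (show (1 : ℕ) ≠ 4 by norm_num), f0, f2, f3, g0, g1]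
    -- For the initial `hi` a single center suffices: the midpoint of the smallest right endpoint
    -- and the largest left endpoint.
    refine ⟨hpos, {β (πB 0) + h₀ / 2}, by simpa using hk1, fun i hi =>
      ⟨_, Finset.mem_singleton_self _, ?_, ?_⟩⟩
    · linarith [hA i hi]
    · linarith [hB i hi]
  rintro t₄ s₄ ⟨d1, d2, d3⟩
  rw [← hc] at d1
  refine wp_seq (wp_setReal (wp_mono (wp_greedy (n := n) (d := s₄.real 5 0) ?_ ?_ ?_ d2.cover.1 ?_)
    ?_))
  · simpa using d2.n_eq
  · simp
  · simpa [d2.β_eq, d2.πB_eq] using b4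
  · simpa [d2.α_eq, d2.β_eq] using hab
  rintro t₅ s₅ ⟨i1, i2, i3, i4⟩
  simp [d2.α_eq, d2.β_eq] at i4
  refine ⟨?_, ?_, ?_, s₄.real 5 0, d2.cover.1, i4, Or.inr d3⟩
  · have h13 : 1000000 * n * (c + 1) = 1000000 * (n * c) + 1000000 * n := by ring
    simp
    omega
  · rw [i2 1 (by norm_num) (by norm_num)]; simpa using d2.k_eq
  · obtain ⟨-, S, hS, hS'⟩ := d2.cover
    exact (i4.chain.le_card hS').trans hS

/-- A program for one dimensional clustering with neighborhoods. -/
def clustering : Program :=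
  .branch (.natLe (.lit 1) (nv 1)) (.seq solve pad) .skip

theorem wp_clustering {n k : ℕ} {a b : Fin n → ℝ} (hab : ∀ i, a i ≤ b i) :
    wp clustering (inputState a b k) fun t s' =>
      t ≤ 3000000 * ((n + 1) * (Nat.clog 2 n + 1) + k) ∧ IsOptimal a b k (outputSet k s') := by
  have ha : ∀ i : Fin n, (inputState a b k).real 0 i = a i := fun i => by simp [inputState]
  have hb : ∀ i : Fin n, (inputState a b k).real 1 i = b i := fun i => by simp [inputState]
  have hpos : 1 ≤ (n + 1) * (Nat.clog 2 n + 1) := Nat.mul_pos (by omega) (by omega)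
  refine wp_branch (fun hk => ?_) (fun hk => ?_)
  · have hk1 : 1 ≤ k := by simpa [inputState] using hk
    refine wp_seq (wp_mono (wp_solve (n := n) (k := k) (by simp [inputState])
      (by simp [inputState]) hk1 ?_) ?_)
    · intro i hi
      rw [ha ⟨i, hi⟩, hb ⟨i, hi⟩]
      exact hab _
    rintro t s₁ ⟨h1, h2, h3, d, hd, hspec, hopt⟩
    refine wp_mono (wp_pad h2 rfl h3 hspec.increasing) ?_
    rintro t' s₂ ⟨i1, i2, i3⟩
    have hcard : (outputSet k s₂).card = k := by
      refine le_antisymm ?_ (le_card_of_increasing (y := s₂.real 2) (fun j hj =>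
        Finset.mem_image_of_mem _ (Finset.mem_range.2 hj)) i2)
      simpa [outputSet] using Finset.card_image_le (s := Finset.range k) (f := s₂.real 2)
    refine ⟨?_, hcard, fun S' hS' => ?_⟩
    · rw [mul_assoc] at h1
      simp
      omega
    -- Padding only adds points to the greedy set, so the output still pierces. For the lower bound,
    -- a competitor has `k` points, one fewer than the chain has intervals; for `d = 0` nothing is
    -- to be shown.
    · have hle : radius a b (outputSet k s₂) ≤ ENNReal.ofReal (d / 2) := by
        refine radius_le_of_pierces hab ha hb hd fun i hi => ?_
        obtain ⟨j, hj, hj'⟩ := hspec.pierced i hi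
        rw [← i3 j hj] at hj'
        exact ⟨_, Finset.mem_image_of_mem _ (Finset.mem_range.2 (by omega)), hj'⟩
      refine hle.trans ?_
      rcases hopt with rfl | hch
      · simp
      · exact hch.le_radius ha hb (by omega)
  · have hk0 : k = 0 := by simpa [inputState] using hk
    subst hk0
    refine wp_skip ⟨by simp; omega, by simp [outputSet], fun S' hS' => ?_⟩
    rw [Finset.card_eq_zero.1 hS']
    simp [outputSet]

end RealRAM

/-! ### From `Nat.clog` to the natural logarithm. -/

theorem clog_two_mul_log_two_le {n : ℕ} (hn : 2 ≤ n) :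
    (Nat.clog 2 n : ℝ) * Real.log 2 ≤ 2 * Real.log n := by
  have h1 : 0 < Nat.clog 2 n := Nat.clog_pos (by norm_num) hn
  have h2 : 2 ^ (Nat.clog 2 n - 1) < n := (Nat.lt_clog_iff_pow_lt (by norm_num)).1 (by omega)
  have h3 : Real.log ((2 : ℝ) ^ (Nat.clog 2 n - 1)) ≤ Real.log n :=
    Real.log_le_log (by positivity) (by exact_mod_cast h2.le)
  rw [Real.log_pow, Nat.cast_sub h1] at h3
  -- For `n ≥ 2` the rounding error `log 2` is absorbed by a second `log n`.
  have h4 : Real.log 2 ≤ Real.log n := Real.log_le_log (by norm_num) (by exact_mod_cast hn)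
  push_cast at h3
  linarith

theorem succ_mul_succ_clog_le {n : ℕ} (hn : 2 ≤ n) :
    (((n + 1) * (Nat.clog 2 n + 1) : ℕ) : ℝ) ≤ 9 * (n * Real.log n) := by
  have h1 := clog_two_mul_log_two_le hn
  have h2 := Real.log_two_gt_d9
  have h3 : Real.log 2 ≤ Real.log n := Real.log_le_log (by norm_num) (by exact_mod_cast hn)
  have h4 : (2 : ℝ) ≤ n := by exact_mod_cast hn
  -- `3 / log 2 < 4.5`; with `n + 1 ≤ 2 * n` this gives the factor 9.
  have h5 : ((Nat.clog 2 n : ℝ) + 1) ≤ 4.5 * Real.log n := by nlinarith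
  push_cast
  nlinarith

theorem mainTheorem7 :
    ∃ (prog : RealRAM.Program) (K : ℕ),
      ∀ (n k : ℕ) (a b : Fin n → ℝ), (∀ i, a i ≤ b i) →
        ∃ (t : ℕ) (s : RealRAM.State),
          RealRAM.Runs prog (Clustering.inputState a b k) t s ∧
          Clustering.IsOptimal a b k (Clustering.outputSet k s) ∧
          (2 ≤ n → k ≤ n → (t : ℝ) ≤ K * (n * Real.log n)) ∧
          (t : ℝ) ≤ K * (n * Real.log n + k + 1) := by
  -- The factor 11 is 9 for the logarithmic term plus 2 for `k ≤ n ≤ 2 * (n * log n)`.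
  refine ⟨RealRAM.clustering, 3000000 * 11, fun n k a b hab => ?_⟩
  obtain ⟨t, s, hrun, ht, hopt⟩ := RealRAM.wp_clustering (k := k) hab
  have ht' : (t : ℝ) ≤ 3000000 * ((((n + 1) * (Nat.clog 2 n + 1) : ℕ) : ℝ) + k) := by
    exact_mod_cast ht
  refine ⟨t, s, hrun, hopt, fun hn hk => ?_, ?_⟩
  · have h1 := succ_mul_succ_clog_le hn
    have h2 : (k : ℝ) ≤ n := by exact_mod_cast hk
    have h3 : Real.log 2 ≤ Real.log n := Real.log_le_log (by norm_num) (by exact_mod_cast hn)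
    have h4 := Real.log_two_gt_d9
    have h5 : (2 : ℝ) ≤ n := by exact_mod_cast hn
    have h6 : (n : ℝ) ≤ 2 * (n * Real.log n) := by nlinarith
    push_cast at *
    linarith
  · have hk0 : (0 : ℝ) ≤ k := Nat.cast_nonneg k
    rcases lt_or_ge n 2 with hn | hn
    · have h1 : ((n + 1) * (Nat.clog 2 n + 1) : ℕ) ≤ 2 := by
        interval_cases n <;> simp
      have h2 : (((n + 1) * (Nat.clog 2 n + 1) : ℕ) : ℝ) ≤ 2 := by exact_mod_cast h1
      have h3 : 0 ≤ n * Real.log n := mul_nonneg (Nat.cast_nonneg n) (Real.log_natCast_nonneg n)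
      push_cast at *
      linarith
    · have h1 := succ_mul_succ_clog_le hn
      have h3 : 0 ≤ n * Real.log n := mul_nonneg (Nat.cast_nonneg n) (Real.log_natCast_nonneg n)
      push_cast at *
      linarith
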